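/- Let $n\ge 0$ and let $\mathcal A=(A_1,\dots,A_n)$ be a finite family of subsets of $\mathbb R^2$. For $\sigma\subseteq[n]=\{1,\dots,n\}$ put $A_\sigma=\bigcap_{i\in\sigma}A_i$, and let $N(\mathcal A)=\{\sigma\subseteq[n] : A_\sigma\neq\emptyset\}$ be the nerve of $\mathcal A$. For an integer $j\ge 0$ let \[ f_j(\mathcal A)=\bigl|\{\sigma\in N(\mathcal A) : |\sigma|=j+1\}\bigr|, \] \[ f^{\mathrm{ind}}_j(\mathcal A)=\bigl|\{\tau\in N(\mathcal A) : |\tau|=j+1\text{ and there is }\sigma\in N(\mathcal A)\text{ with }\sigma\supset\tau,\ |\sigma|=j+2\}\bigr|. \] **Theorem 2.1.** Let $k\ge 2$ be an integer, and suppose that 1. $f_{k+1}(\mathcal A)=0$, that is, no $k+2$ of the sets (with distinct indices) have a common point; 2. for each $\sigma\subseteq[n]$ with $|\sigma|\in\{k,k+1\}$, the set $A_\sigma$ is empty, or a single point, or both open in $\mathbb R^2$ and path-connected. Then \[ f_k(\mathcal A)\le c(k)\, f^{\mathrm{ind}}_{k-1}(\mathcal A),\qquad\text{where } c(k)=\frac{4k+1}{4k^2-7k+1}>0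 . \] -/

import Mathlib

namespace PlanarNerve

/-- `inter A σ` is the intersection `A_σ` of the sets `A i`, `i ∈ σ`. -/
def inter {X : Type*} {n : ℕ} (A : Fin n → Set X) (σ : Finset (Fin n)) : Set X :=
  ⋂ i ∈ σ, A i

/-- The nerve `N(A)` of a finite family `A 0, …, A (n - 1)`: all index sets `σ` with nonempty
`A_σ`. -/
def nerve {X : Type*} {n : ℕ} (A : Fin n → Set X) : Set (Finset (Fin n)) :=
  {σ | (inter A σ).Nonempty}

/-- `f_k(A)`: the number of faces of the nerve with `k + 1` elements. -/
noncomputable def faceCount {X : Type*} {n : ℕ} (A : Fin n → Set X) (k : ℕ) : ℕ :=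
  Set.ncard {σ : Finset (Fin n) | σ ∈ nerve A ∧ σ.card = k + 1}

/-- `f^ind_k(A)`: the number of faces of the nerve with `k + 1` elements that are contained in
some face with `k + 2` elements. -/
noncomputable def indFaceCount {X : Type*} {n : ℕ} (A : Fin n → Set X) (k : ℕ) : ℕ :=
  Set.ncard {τ : Finset (Fin n) | τ ∈ nerve A ∧ τ.card = k + 1 ∧
    ∃ σ ∈ nerve A, τ ⊂ σ ∧ σ.card = k + 2}

/-- The constant `c(k) = (4k + 1) / (4k² - 7k + 1)`. -/
noncomputable def boundConst (k : ℕ) : ℝ :=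
  (4 * (k : ℝ) + 1) / (4 * (k : ℝ) ^ 2 - 7 * (k : ℝ) + 1)

end PlanarNerve

/-!
The faces `σ` with `k + 1` elements and `A_σ ≠ ∅` have disjoint intersections `A_σ`, because no
`k + 2` of the sets meet. If `A_σ` is not open, it is a point, and so are all but at most one of the
`A_τ` with `τ ⊆ σ`, `|τ| = k`; these `τ` lie in no other face, so that `σ` alone accounts for at
least `k` faces counted by `f^ind` (`card_add_le_indFaceCount`). This leaves the faces `σ` with
`A_σ` open, and the ridges `τ` below them, for which `A_τ` is open and path-connected. Two distinct
`A_τ`, `A_τ'` overlap only in `A_(τ ∪ τ')`. Join, for each `τ`, the `d_τ` regions `A_σ` with `σ ⊇ τ`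
by a tree inside `A_τ`, and contract the regions `A_σ`: the result is a simple planar graph whose
vertices are the `σ`, with `∑ (d_τ - 1)` edges, and `∑ d_τ` is `k + 1` times the number of vertices.

A planar graph with `v` vertices has at most `3 v` edges, but here triangular faces are scarce. The
edges of a triangle cannot all belong to the tree of the same `τ`, and therefore its three vertices
are subsets of one set `ω` with `k + 2` elements, the union of the ends of any of its edges. So
triangles sharing an edge have the same `ω`. At most `3 k` edges belong to a given `ω`, by the usual
bound for the at most `k + 2` vertices in `ω`. The sum modulo 2 of the boundaries of the triangles
in `ω` is a cycle; if it is not zero, it has at least three edges, and each of them lies on exactly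
one triangle. If it is zero and there are triangles in `ω`, these make up whole components of the
dual graph, which improves Euler's inequality by one. Thus, among the edges of every `ω`, the number
of missing triangles (two minus the number of triangles, summed over the edges), plus 12 in the
latter case, is at least `1 / k` times the number of edges. Inserted into Euler's inequality, this
bounds the number `e` of edges by `(4 k + 1) e ≤ 12 k v` (`IsDual.mul_card_edges_le`), which gives
the constant `c(k)`.

Planarity enters in algebraic form only, so that neither the Jordan curve theorem nor plane drawings
are needed: `IsDual` says that the cycles of a graph modulo 2 are the coboundaries of functions on a
set of faces. This holds for finite square grids (`isDual_grid`), passes to minors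
(`IsDual.exists_minor`), and implies the inequality in Euler's formula (`IsDual.card_add_card_le`).
The graph above is obtained as a minor of a fine grid (`exists_grid_model`, `exists_linked_cover`,
`IsDual.exists_tree_minor`).
-/

namespace PlanarNerve

universe u

/-! ### Algebraic planar duality -/

/-- The coboundary over `ZMod 2` of a function `φ` on the vertices of the multigraph whose edge `e`
joins `a e` to `b e`. -/
def coboundary {V E : Type*} (a b : E → V) (φ : V → ZMod 2) (e : E) : ZMod 2 :=
  φ (a e) + φ (b e)

/-- Algebraic duality of two multigraphs on the same finite edge set `E`: the edge `e` joins the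
vertices `a e` and `b e` of the first and separates the faces `l e` and `r e` of the second, and the
cycles modulo 2 of the first (the functions orthogonal to all coboundaries) are the coboundaries of
the second. Having a dual takes the place of being drawn in the plane. -/
def IsDual {V E F : Type*} [Fintype E] (a b : E → V) (l r : E → F) : Prop :=
  ∀ z : E → ZMod 2, (∀ φ : V → ZMod 2, ∑ e, z e * coboundary a b φ e = 0) ↔
    ∃ g : F → ZMod 2, ∀ e, z e = coboundary l r g e

theorem zmod_two_add_eq_zero {x y : ZMod 2} : x + y = 0 ↔ x = y := by
  revert x y; decide

/-- Minors of a graph with a dual have a dual. The edges in `con` are contracted, those in the range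
of `ι` are kept, all others are deleted; the vertices of the minor enter only through the
coboundaries of the functions on them. -/
theorem IsDual.exists_minor {V E V' E' : Type*} {F : Type u} [Fintype E] [Fintype E']
    {a b : E → V} {l r : E → F} (h : IsDual a b l r) (a' b' : E' → V') (ι : E' → E)
    (hι : Function.Injective ι) (con : Set E) (hcon : ∀ e, ι e ∉ con)
    (h₁ : ∀ φ : V → ZMod 2, (∀ e ∈ con, coboundary a b φ e = 0) →
      ∃ φ' : V' → ZMod 2, ∀ e, coboundary a' b' φ' e = coboundary a b φ (ι e))
    (h₂ : ∀ φ' : V' → ZMod 2, ∃ φ : V → ZMod 2, (∀ e ∈ con, coboundary a b φ e = 0) ∧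
      ∀ e, coboundary a' b' φ' e = coboundary a b φ (ι e)) :
    ∃ (F' : Type u) (l' r' : E' → F'), IsDual a' b' l' r' := by
  classical
  -- Deleting an edge merges the two faces at it.
  let s : Setoid F :=
    { r := fun f f' => ∀ g : F → ZMod 2, (∀ e, e ∉ con → e ∉ Set.range ι → g (l e) = g (r e)) →
        g f = g f'
      iseqv := ⟨fun _ _ _ => rfl, fun h g hg => (h g hg).symm,
        fun h h' g hg => (h g hg).trans (h' g hg)⟩ }
  refine ⟨Quotient s, fun e => Quotient.mk s (l (ι e)), fun e => Quotient.mk s (r (ι e)), ?_⟩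
  have sum_eq : ∀ w : E → ZMod 2, (∀ e, e ∉ Set.range ι → w e = 0) →
      ∑ e, w e = ∑ e, w (ι e) := by
    intro w hw
    rw [← Finset.sum_image (s := Finset.univ) (g := ι) (f := w) (fun x _ y _ h => hι h)]
    symm
    apply Finset.sum_subset (Finset.subset_univ _)
    intro e _ he
    apply hw
    simpa using he
  intro z'
  constructor
  · intro hz'
    set z : E → ZMod 2 := Function.extend ι z' 0 with hz
    have hzι : ∀ e, z (ι e) = z' e := fun e => hι.extend_apply _ _ _
    have hz0 : ∀ e, e ∉ Set.range ι → z e = 0 := fun e he => by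
      rw [hz, Function.extend_apply' _ _ _ (by simpa using he)]; rfl
    let P : V → (V → ZMod 2) →ₗ[ZMod 2] ZMod 2 := LinearMap.proj
    let L : con → (V → ZMod 2) →ₗ[ZMod 2] ZMod 2 := fun e => P (a e) + P (b e)
    let K : (V → ZMod 2) →ₗ[ZMod 2] ZMod 2 :=
      ∑ e, z e • (P (a e) + P (b e))
    have hK : ∀ φ, K φ = ∑ e, z e * coboundary a b φ e := by
      intro φ; simp [K, P, coboundary, mul_add]
    have hL : ∀ e φ, L e φ = coboundary a b φ e := by
      intro e φ; simp [L, P, coboundary]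
    -- `z'` extended by zero is orthogonal to the coboundaries that vanish on contracted edges, so it
    -- becomes a cycle after a correction `Y` supported on these edges.
    have hmem : K ∈ Submodule.span (ZMod 2) (Set.range L) := by
      apply mem_span_of_iInf_ker_le_ker
      intro φ hφ
      simp only [Submodule.mem_iInf, LinearMap.mem_ker, hL] at hφ
      obtain ⟨φ', hφ'⟩ := h₁ φ (fun e he => hφ ⟨e, he⟩)
      rw [LinearMap.mem_ker, hK, sum_eq _ (fun e he => by rw [hz0 e he, zero_mul])]
      simp only [hzι, ← hφ']
      exact hz' φ'
    obtain ⟨y, hy⟩ := (Submodule.mem_span_range_iff_exists_fun (ZMod 2)).1 hmem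
    set Y : E → ZMod 2 := fun e => if he : e ∈ con then y ⟨e, he⟩ else 0 with hY
    have hYK : ∀ φ, ∑ e, Y e * coboundary a b φ e = K φ := by
      intro φ
      rw [← hy]
      simp only [LinearMap.sum_apply, LinearMap.smul_apply, hL, smul_eq_mul]
      rw [← Finset.sum_subset (Finset.subset_univ (Finset.univ.filter (· ∈ con)))
        (fun e _ he => by simp [hY, show e ∉ con by simpa using he]),
        ← Finset.sum_subtype_of_mem (p := (· ∈ con)) _ (by simp), Finset.subtype_eq_univ.2 (by simp)]
      exact Finset.sum_congr rfl fun e _ => by simp [hY, e.2]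
    obtain ⟨g, hg⟩ := (h (z + Y)).1 (by
      intro φ
      simp only [Pi.add_apply, add_mul, Finset.sum_add_distrib]
      rw [← hK, hYK]
      exact CharTwo.add_self_eq_zero _)
    refine ⟨Quotient.lift g (fun f f' hff => hff g ?_), ?_⟩
    · intro e he he'
      have := hg e
      simp only [Pi.add_apply, hz0 e he', hY, he, dite_false, add_zero, coboundary] at this
      exact zmod_two_add_eq_zero.1 this.symm
    · intro e
      have := hg (ι e)
      simp only [Pi.add_apply, hzι, hY, hcon e, dite_false, add_zero] at this
      exact this
  · rintro ⟨g', hg'⟩ φ'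
    obtain ⟨φ, hφ, hφ'⟩ := h₂ φ'
    have key := (h (coboundary l r (fun f => g' (Quotient.mk s f)))).2 ⟨_, fun e => rfl⟩ φ
    rw [sum_eq] at key
    · rw [← key]
      refine Finset.sum_congr rfl fun e _ => ?_
      rw [hg', hφ']
      rfl
    · intro e he
      by_cases hc : e ∈ con
      · rw [hφ e hc, mul_zero]
      · have : Quotient.mk s (l e) = Quotient.mk s (r e) :=
          Quotient.sound fun g hg => hg e hc he
        simp only [coboundary, this, CharTwo.add_self_eq_zero, zero_mul]

theorem sum_range_add_succ_mul (N : ℕ) (f ψ : ℕ → ZMod 2) (h0 : f 0 = 0) (hN : f N = 0) :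
    ∑ j ∈ Finset.range N, (f (j + 1) + f j) * ψ j =
      ∑ j ∈ Finset.range N, f (j + 1) * (ψ j + ψ (j + 1)) := by
  have h1 := Finset.sum_range_succ (fun j => f j * ψ j) N
  have h2 := Finset.sum_range_succ' (fun j => f j * ψ j) N
  rw [h1] at h2
  simp only [h0, hN, zero_mul, add_zero] at h2
  simp only [add_mul, mul_add, Finset.sum_add_distrib, h2]

/-- First end of an edge of the `N × N` grid: `(i, j, false)` is the horizontal edge from `(i, j)`
to `(i + 1, j)`, and `(i, j, true)` the vertical edge from `(i, j)` to `(i, j + 1)`. -/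
def gridFst {N : ℕ} (e : Fin N × Fin N × Bool) : ℕ × ℕ := (e.1, e.2.1)

/-- Second end of an edge of the `N × N` grid. -/
def gridSnd {N : ℕ} (e : Fin N × Fin N × Bool) : ℕ × ℕ :=
  if e.2.2 then (e.1, e.2.1 + 1) else (e.1 + 1, e.2.1)

/-- The face of the `N × N` grid with upper right corner `(i, j)`; all of them that are
unbounded are encoded as `(0, 0)`. -/
def gridFace (N i j : ℕ) : ℕ × ℕ :=
  if 0 < i ∧ i < N ∧ 0 < j ∧ j < N then (i, j) else (0, 0)

/-- The face above a horizontal edge, or to the right of a vertical one. -/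
def gridLeft {N : ℕ} (e : Fin N × Fin N × Bool) : ℕ × ℕ := gridFace N (e.1 + 1) (e.2.1 + 1)

/-- The face below a horizontal edge, or to the left of a vertical one. -/
def gridRight {N : ℕ} (e : Fin N × Fin N × Bool) : ℕ × ℕ :=
  if e.2.2 then gridFace N e.1 (e.2.1 + 1) else gridFace N (e.1 + 1) e.2.1

theorem sum_grid {N : ℕ} (w : ℕ → ℕ → Bool → ZMod 2) :
    ∑ e : Fin N × Fin N × Bool, w e.1 e.2.1 e.2.2 =
      ∑ i ∈ Finset.range N, ∑ j ∈ Finset.range N, (w i j false + w i j true) := by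
  rw [Fintype.sum_prod_type, ← Fin.sum_univ_eq_sum_range
    (fun i => ∑ j ∈ Finset.range N, (w i j false + w i j true))]
  refine Finset.sum_congr rfl fun i _ => ?_
  rw [Fintype.sum_prod_type, ← Fin.sum_univ_eq_sum_range
    (fun j => (w i j false + w i j true))]
  refine Finset.sum_congr rfl fun j _ => ?_
  simp [add_comm]

/-- A coboundary of faces is orthogonal to the coboundaries of vertices: summation by parts. -/
theorem sum_grid_coboundary_mul (N : ℕ) (G φ : ℕ → ℕ → ZMod 2)
    (hi0 : ∀ j, G 0 j = 0) (hiN : ∀ j, G N j = 0) (hj0 : ∀ i, G i 0 = 0) (hjN : ∀ i, G i N = 0) :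
    ∑ i ∈ Finset.range N, ∑ j ∈ Finset.range N,
      ((G (i + 1) (j + 1) + G (i + 1) j) * (φ i j + φ (i + 1) j) +
        (G (i + 1) (j + 1) + G i (j + 1)) * (φ i j + φ i (j + 1))) = 0 := by
  simp only [Finset.sum_add_distrib]
  have h1 : ∀ i, ∑ j ∈ Finset.range N,
      (G (i + 1) (j + 1) + G (i + 1) j) * (φ i j + φ (i + 1) j) = _ := fun i =>
    sum_range_add_succ_mul N (fun j => G (i + 1) j) (fun j => φ i j + φ (i + 1) j)
      (hj0 _) (hjN _)
  have h2 : ∀ j, ∑ i ∈ Finset.range N,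
      (G (i + 1) (j + 1) + G i (j + 1)) * (φ i j + φ i (j + 1)) = _ := fun j =>
    sum_range_add_succ_mul N (fun i => G i (j + 1)) (fun i => φ i j + φ i (j + 1))
      (hi0 _) (hiN _)
  rw [Finset.sum_comm (f := fun i j => (G (i + 1) (j + 1) + G i (j + 1)) * (φ i j + φ i (j + 1)))]
  simp only [h1, h2]
  rw [Finset.sum_comm, ← Finset.sum_add_distrib]
  refine Finset.sum_eq_zero fun j _ => ?_
  rw [← Finset.sum_add_distrib]
  refine Finset.sum_eq_zero fun i _ => ?_
  generalize G (i + 1) (j + 1) = x, φ i j = p, φ (i + 1) j = q, φ i (j + 1) = t,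
    φ (i + 1) (j + 1) = u
  revert x p q t u; decide

/-- Pairing a function on the edges with the coboundary of the indicator of the vertical segment
from `(i, 0)` to `(i, j)`. -/
theorem sum_grid_segment (M : ℕ) (h v : ℕ → ℕ → ZMod 2) (i j : ℕ) (hi : i < M) (hj : j < M) :
    ∑ x ∈ Finset.range M, ∑ y ∈ Finset.range M,
      (h x y * ((if x = i ∧ y ≤ j then 1 else 0) + if x + 1 = i ∧ y ≤ j then 1 else 0) +
        v x y * ((if x = i ∧ y ≤ j then 1 else 0) + if x = i ∧ y + 1 ≤ j then 1 else 0)) =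
      ∑ y ∈ Finset.range (j + 1), h i y +
        (if 0 < i then ∑ y ∈ Finset.range (j + 1), h (i - 1) y else 0) + v i j := by
  have hsum : ∀ (f : ℕ → ZMod 2), ∑ y ∈ Finset.range M, (if y ≤ j then f y else 0) =
      ∑ y ∈ Finset.range (j + 1), f y := by
    intro f
    rw [← Finset.sum_filter]
    refine Finset.sum_congr ?_ fun _ _ => rfl
    ext y; simp; omega
  have h1 : ∀ x, ∑ y ∈ Finset.range M, h x y * (if x = i ∧ y ≤ j then 1 else 0) =
      if x = i then ∑ y ∈ Finset.range (j + 1), h x y else 0 := by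
    intro x
    by_cases hx : x = i <;> simp [hx, hsum]
  have h2 : ∀ x, ∑ y ∈ Finset.range M, h x y * (if x + 1 = i ∧ y ≤ j then 1 else 0) =
      if x + 1 = i then ∑ y ∈ Finset.range (j + 1), h x y else 0 := by
    intro x
    by_cases hx : x + 1 = i <;> simp [hx, hsum]
  have h3 : ∀ x, ∑ y ∈ Finset.range M, v x y *
      ((if x = i ∧ y ≤ j then 1 else 0) + if x = i ∧ y + 1 ≤ j then 1 else 0) =
      if x = i then v x j else 0 := by
    intro x
    by_cases hx : x = i
    · rw [Finset.sum_eq_single j]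
      · simp [hx]
      · intro y _ hy
        rcases Nat.lt_or_gt_of_ne hy with h | h
        · simp [hx, h.le, Nat.succ_le_of_lt h, CharTwo.add_self_eq_zero]
        · simp [hx, show ¬ y ≤ j by omega, show ¬ y + 1 ≤ j by omega]
      · simp [hj]
    · simp [hx]
  simp only [Finset.sum_add_distrib, mul_add (h _ _), h1, h2, h3]
  congr 1
  · congr 1
    · simp [hi]
    · rcases i with _ | i
      · simp
      · simp [show i < M by omega]
  · simp [hi]

theorem isDual_grid (N : ℕ) :
    IsDual (gridFst (N := N)) gridSnd gridLeft gridRight := by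
  intro z
  constructor
  · intro hz
    set h : ℕ → ℕ → ZMod 2 := fun x y =>
      if hxy : x < N ∧ y < N then z (⟨x, hxy.1⟩, ⟨y, hxy.2⟩, false) else 0 with hh
    set v : ℕ → ℕ → ZMod 2 := fun x y =>
      if hxy : x < N ∧ y < N then z (⟨x, hxy.1⟩, ⟨y, hxy.2⟩, true) else 0 with hv
    have hz' : ∀ (φ : ℕ → ℕ → ZMod 2), ∑ x ∈ Finset.range N, ∑ y ∈ Finset.range N,
        (h x y * (φ x y + φ (x + 1) y) + v x y * (φ x y + φ x (y + 1))) = 0 := by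
      intro φ
      have hs := sum_grid (N := N) (fun x y c => (if c then v x y else h x y) *
        (φ x y + (if c then φ x (y + 1) else φ (x + 1) y)))
      simp only [if_true, Bool.false_eq_true, if_false] at hs
      rw [← hs, ← hz (fun p => φ p.1 p.2)]
      refine Finset.sum_congr rfl fun e _ => ?_
      obtain ⟨x, y, c⟩ := e
      cases c <;> simp [hh, hv, coboundary, gridFst, gridSnd]
    -- `G (i + 1) j` sums the horizontal edges below `j` in column `i`.
    set G : ℕ → ℕ → ZMod 2 := fun x y =>
      if 0 < x then ∑ y' ∈ Finset.range y, h (x - 1) y' else 0 with hG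
    have hstep : ∀ i j, G (i + 1) (j + 1) + G i (j + 1) + v i j = 0 := by
      intro i j
      set M := N + i + j + 1
      have := sum_grid_segment M h v i j (by omega) (by omega)
      simp only [hG, Nat.succ_pos, if_true, Nat.add_sub_cancel]
      rw [← this]
      refine Eq.trans ?_ (hz' (fun x y => if x = i ∧ y ≤ j then 1 else 0))
      symm
      refine Finset.sum_subset_zero_on_sdiff (by simp; omega) ?_ ?_
      · intro x hx
        have hx : ¬ x < N := by simpa using (Finset.mem_sdiff.1 hx).2
        simp [hh, hv, hx]
      · intro x hx
        refine Finset.sum_subset_zero_on_sdiff (by simp; omega) ?_ fun _ _ => rfl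
        intro y hy
        have hy : ¬ y < N := by simpa using (Finset.mem_sdiff.1 hy).2
        simp [hh, hv, hy]
    have hG0 : ∀ j, G 0 j = 0 := by simp [hG]
    have hGj0 : ∀ i, G i 0 = 0 := by simp [hG]
    have hGjN' : ∀ j, N ≤ j → ∀ i, G i (j + 1) = 0 := by
      intro j hj i
      induction i with
      | zero => exact hG0 _
      | succ i ih =>
        have := hstep i j
        rwa [ih, show v i j = 0 by simp [hv, hj], add_zero, add_zero] at this
    have hGjN : ∀ j, N ≤ j → ∀ i, G i j = 0 := by
      intro j hj i
      have h1 := hGjN' j hj i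
      rcases i with _ | i
      · exact hG0 _
      · simp only [hG, Nat.succ_pos, if_true] at h1 ⊢
        rwa [Finset.sum_range_succ, show h (i + 1 - 1) j = 0 by simp [hh, hj], add_zero] at h1
    have hGiN' : ∀ i, N ≤ i → ∀ j, G (i + 1) j = 0 := by
      intro i hi j
      simp only [hG, Nat.succ_pos, if_true]
      exact Finset.sum_eq_zero fun y _ => by simp [hh, hi]
    have hGiN : ∀ i, N ≤ i → ∀ j, G i j = 0 := by
      intro i hi j
      rcases j with _ | j
      · exact hGj0 _
      · have := hstep i j
        rwa [hGiN' i hi, show v i j = 0 by simp [hv, hi], add_zero, zero_add] at this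
    have hface : ∀ i j, G (gridFace N i j).1 (gridFace N i j).2 = G i j := by
      intro i j
      unfold gridFace
      split_ifs with hc
      · rfl
      · rw [hG0]
        symm
        by_cases h1 : 0 < i
        · by_cases h2 : i < N
          · by_cases h3 : 0 < j
            · exact hGjN j (by by_contra h4; exact hc ⟨h1, h2, h3, by omega⟩) i
            · rw [show j = 0 by omega, hGj0]
          · exact hGiN i (by omega) j
        · rw [show i = 0 by omega, hG0]
    refine ⟨fun p => G p.1 p.2, ?_⟩
    rintro ⟨x, y, c⟩
    cases c
    · simp only [coboundary, gridLeft, gridRight, hface, Bool.false_eq_true, if_false]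
      have : z (x, y, false) = h x y := by simp [hh]
      rw [this]
      simp only [hG, Nat.succ_pos, if_true, Nat.add_sub_cancel, Finset.sum_range_succ]
      generalize ∑ y' ∈ Finset.range y.1, h x y' = s, h x y = t
      revert s t; decide
    · simp only [coboundary, gridLeft, gridRight, hface, if_true]
      have : z (x, y, true) = v x y := by simp [hv]
      rw [this]
      exact (zmod_two_add_eq_zero.1 (hstep x y)).symm
  · rintro ⟨g, hg⟩ φ
    have key := sum_grid_coboundary_mul N (fun i j => g (gridFace N i j) + g (0, 0))
      (fun i j => φ (i, j)) (by simp [gridFace, CharTwo.add_self_eq_zero])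
      (by simp [gridFace, CharTwo.add_self_eq_zero])
      (by simp [gridFace, CharTwo.add_self_eq_zero])
      (by simp [gridFace, CharTwo.add_self_eq_zero])
    have hs := sum_grid (N := N) (fun i j c => (g (gridFace N (i + 1) (j + 1)) +
      g (if c then gridFace N i (j + 1) else gridFace N (i + 1) j)) *
      (φ (i, j) + φ (if c then (i, j + 1) else (i + 1, j))))
    simp only [hg]
    refine Eq.trans hs (Eq.trans ?_ key)
    refine Finset.sum_congr rfl fun i _ => Finset.sum_congr rfl fun j _ => ?_
    have : ∀ x y t : ZMod 2, x + y = (x + t) + (y + t) := by decide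
    simp only [if_true, Bool.false_eq_true, if_false]
    rw [this (g (gridFace N (i + 1) (j + 1))) (g (gridFace N (i + 1) j)) (g (0, 0)),
      this (g (gridFace N (i + 1) (j + 1))) (g (gridFace N i (j + 1))) (g (0, 0))]

/-! ### Cycles, faces and Euler's inequality -/

section Cycles

variable {V E : Type*} [Fintype E] {a b : E → V}

theorem exists_ne_of_cycle {z : E → ZMod 2} (hab : ∀ e, a e ≠ b e)
    (hz : ∀ φ : V → ZMod 2, ∑ e, z e * coboundary a b φ e = 0) {e : E} (he : z e ≠ 0) {u : V}
    (hu : u ∈ s(a e, b e)) : ∃ e', e' ≠ e ∧ z e' ≠ 0 ∧ u ∈ s(a e', b e') := by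
  classical
  by_contra! hcon
  have h := hz (Pi.single u 1)
  rw [Finset.sum_eq_single e] at h
  · rcases Sym2.mem_iff.1 hu with rfl | rfl
    · simp [coboundary, (hab e).symm, he] at h
    · simp [coboundary, hab e, he] at h
  · intro e' _ he'
    by_cases hz' : z e' = 0
    · rw [hz', zero_mul]
    · have := hcon e' he' hz'
      simp only [Sym2.mem_iff, not_or] at this
      simp [coboundary, Ne.symm this.1, Ne.symm this.2]
  · simp

/-- The edges of a nonzero cycle in a simple graph that are adjacent to a given one, at its two
ends. -/
theorem exists_three_of_cycle {z : E → ZMod 2} (hab : ∀ e, a e ≠ b e)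
    (hinj : ∀ e e', s(a e, b e) = s(a e', b e') → e = e')
    (hz : ∀ φ : V → ZMod 2, ∑ e, z e * coboundary a b φ e = 0) {e : E} (he : z e ≠ 0) :
    ∃ e₂ e₃, e₂ ≠ e ∧ e₃ ≠ e ∧ e₂ ≠ e₃ ∧ z e₂ ≠ 0 ∧ z e₃ ≠ 0 ∧
      a e ∈ s(a e₂, b e₂) ∧ b e ∈ s(a e₃, b e₃) := by
  obtain ⟨e₂, h2, hz2, hm2⟩ := exists_ne_of_cycle hab hz he (Sym2.mem_mk_left _ _)
  obtain ⟨e₃, h3, hz3, hm3⟩ := exists_ne_of_cycle hab hz he (Sym2.mem_mk_right _ _)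
  refine ⟨e₂, e₃, h2, h3, ?_, hz2, hz3, hm2, hm3⟩
  rintro rfl
  exact h2 (hinj _ _ ((Sym2.mem_and_mem_iff (hab e)).1 ⟨hm2, hm3⟩))

theorem three_le_card_of_cycle {z : E → ZMod 2} (hab : ∀ e, a e ≠ b e)
    (hinj : ∀ e e', s(a e, b e) = s(a e', b e') → e = e')
    (hz : ∀ φ : V → ZMod 2, ∑ e, z e * coboundary a b φ e = 0) {e : E} (he : z e ≠ 0)
    {T : Finset E} (hT : ∀ e, z e ≠ 0 → e ∈ T) : 3 ≤ T.card := by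
  classical
  obtain ⟨e₂, e₃, h2, h3, h23, hz2, hz3, -, -⟩ := exists_three_of_cycle hab hinj hz he
  calc 3 = ({e, e₂, e₃} : Finset E).card := by
        rw [Finset.card_eq_three.2 ⟨e, e₂, e₃, h2.symm, h3.symm, h23, rfl⟩]
    _ ≤ T.card := Finset.card_le_card (by
        intro x hx
        simp only [Finset.mem_insert, Finset.mem_singleton] at hx
        rcases hx with rfl | rfl | rfl <;> exact hT _ ‹_›)

/-- In a simple graph a cycle with three edges is a triangle. -/
theorem exists_triangle_of_cycle {z : E → ZMod 2} (hab : ∀ e, a e ≠ b e)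
    (hinj : ∀ e e', s(a e, b e) = s(a e', b e') → e = e')
    (hz : ∀ φ : V → ZMod 2, ∑ e, z e * coboundary a b φ e = 0)
    {T : Finset E} (hT : ∀ e, z e ≠ 0 ↔ e ∈ T) (hT3 : T.card = 3) {e : E} (he : e ∈ T) :
    ∃ e₂ e₃ w, w ≠ a e ∧ w ≠ b e ∧ s(a e₂, b e₂) = s(a e, w) ∧ s(a e₃, b e₃) = s(b e, w) ∧
      ∀ e' ∈ T, e' = e ∨ e' = e₂ ∨ e' = e₃ := by
  classical
  obtain ⟨e₂, e₃, h2, h3, h23, hz2, hz3, hm2, hm3⟩ :=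
    exists_three_of_cycle hab hinj hz ((hT e).2 he)
  have hTeq : ({e, e₂, e₃} : Finset E) = T := by
    apply Finset.eq_of_subset_of_card_le
    · intro x hx
      simp only [Finset.mem_insert, Finset.mem_singleton] at hx
      rcases hx with rfl | rfl | rfl
      · exact he
      · exact (hT _).1 hz2
      · exact (hT _).1 hz3
    · rw [hT3, Finset.card_eq_three.2 ⟨e, e₂, e₃, h2.symm, h3.symm, h23, rfl⟩]
  have hall : ∀ e' ∈ T, e' = e ∨ e' = e₂ ∨ e' = e₃ := by
    intro e' h'
    rw [← hTeq] at h'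
    simpa using h'
  obtain ⟨w, hw⟩ := Sym2.mem_iff_exists.1 hm2
  have hwa : w ≠ a e := by
    rintro rfl
    have := hab e₂
    rcases Sym2.eq_iff.1 hw with h | h <;> exact this (h.1.trans h.2.symm)
  have hwb : w ≠ b e := by
    rintro rfl
    exact h2 (hinj _ _ hw)
  obtain ⟨e₄, h4, hz4, hm4⟩ := exists_ne_of_cycle hab hz hz2 (u := w) (by rw [hw]; simp)
  refine ⟨e₂, e₃, w, hwa, hwb, hw, ?_, hall⟩
  rcases hall e₄ ((hT _).1 hz4) with rfl | rfl | rfl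
  · rcases Sym2.mem_iff.1 hm4 with h | h
    · exact absurd h hwa
    · exact absurd h hwb
  · exact absurd rfl h4
  · exact (Sym2.mem_and_mem_iff hwb.symm).1 ⟨hm3, hm4⟩

end Cycles

/-- The edges that separate the face `f` from another face. -/
noncomputable def faceBoundary {E F : Type*} [Fintype E] (l r : E → F) (f : F) : Finset E := by
  classical exact Finset.univ.filter fun e => l e ≠ r e ∧ (l e = f ∨ r e = f)

theorem mem_faceBoundary {E F : Type*} [Fintype E] {l r : E → F} {f : F} {e : E} :
    e ∈ faceBoundary l r f ↔ l e ≠ r e ∧ (l e = f ∨ r e = f) := by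
  simp [faceBoundary]

/-- The faces that some edge separates from another face. -/
noncomputable def properFaces {E F : Type*} [Fintype E] (l r : E → F) : Finset F := by
  classical exact (Finset.univ.filter fun e => l e ≠ r e).image l ∪
    (Finset.univ.filter fun e => l e ≠ r e).image r

theorem mem_properFaces {E F : Type*} [Fintype E] {l r : E → F} {f : F} :
    f ∈ properFaces l r ↔ (faceBoundary l r f).Nonempty := by
  simp only [properFaces, Finset.mem_union, Finset.mem_image, Finset.mem_filter, Finset.mem_univ,
    true_and, Finset.Nonempty, mem_faceBoundary]
  grind

/-- The indicator function of a set of faces has as coboundary the edges that leave the set. -/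
theorem coboundary_indicator_ne_zero {E F : Type*} {l r : E → F} (P : F → Prop)
    [DecidablePred P] {e : E} :
    coboundary l r (fun f => if P f then 1 else 0) e ≠ 0 ↔ ¬ (P (l e) ↔ P (r e)) := by
  by_cases h1 : P (l e) <;> by_cases h2 : P (r e) <;> simp [coboundary, h1, h2]; decide

/-- The inequality in Euler's formula. Each set `Φ i` of faces that no edge leaves is a union of
connected components of the dual graph. -/
theorem IsDual.card_add_card_le {V E F I : Type*} [Fintype V] [Nonempty V] [Fintype E] [Fintype I]
    {a b : E → V} {l r : E → F} (h : IsDual a b l r)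
    (Φ : I → Finset F) (hsub : ∀ i, Φ i ⊆ properFaces l r) (hne : ∀ i, (Φ i).Nonempty)
    (hdisj : ∀ i j f, f ∈ Φ i → f ∈ Φ j → i = j) (hcl : ∀ i e, l e ∈ Φ i ↔ r e ∈ Φ i) :
    Fintype.card E + 1 + Fintype.card I ≤ Fintype.card V + (properFaces l r).card := by
  classical
  let M : (E → ZMod 2) →ₗ[ZMod 2] (V → ZMod 2) :=
    { toFun := fun z v => ∑ e, z e * coboundary a b (Pi.single v 1) e
      map_add' := fun z w => by ext v; simp [add_mul, Finset.sum_add_distrib]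
      map_smul' := fun c z => by ext v; simp [Finset.mul_sum, mul_assoc] }
  let S : (V → ZMod 2) →ₗ[ZMod 2] ZMod 2 := ∑ v, LinearMap.proj v
  let ext : (properFaces l r → ZMod 2) → F → ZMod 2 := fun g f =>
    if hf : f ∈ properFaces l r then g ⟨f, hf⟩ else 0
  let D : (properFaces l r → ZMod 2) →ₗ[ZMod 2] (E → ZMod 2) :=
    { toFun := fun g => coboundary l r (ext g)
      map_add' := fun g g' => by
        funext e
        show ext (g + g') (l e) + ext (g + g') (r e) =
          ext g (l e) + ext g (r e) + (ext g' (l e) + ext g' (r e))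
        simp only [ext, Pi.add_apply]
        split_ifs <;> ring
      map_smul' := fun c g => by
        funext e
        show ext (c • g) (l e) + ext (c • g) (r e) = c * (ext g (l e) + ext g (r e))
        simp only [ext, Pi.smul_apply, smul_eq_mul]
        split_ifs <;> simp [mul_add] }
  have hD : ∀ g e, D g e = ext g (l e) + ext g (r e) := fun _ _ => rfl
  have hSM : LinearMap.range M ≤ LinearMap.ker S := by
    rintro _ ⟨z, rfl⟩
    rw [LinearMap.mem_ker]
    simp only [S, M, LinearMap.sum_apply, LinearMap.proj_apply, LinearMap.coe_mk, AddHom.coe_mk]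
    rw [Finset.sum_comm]
    refine Finset.sum_eq_zero fun e _ => ?_
    rw [← Finset.mul_sum]
    simp [coboundary, Finset.sum_add_distrib, Pi.single_apply, CharTwo.add_self_eq_zero]
  have hS : LinearMap.range S = ⊤ := by
    rw [LinearMap.range_eq_top]
    intro c
    refine ⟨Pi.single (Classical.arbitrary V) c, ?_⟩
    simp [S]
  have hMD : LinearMap.ker M ≤ LinearMap.range D := by
    intro z hz
    have hz' : ∀ v, ∑ e, z e * coboundary a b (Pi.single v 1) e = 0 := fun v =>
      congrFun (LinearMap.mem_ker.1 hz) v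
    obtain ⟨g, hg⟩ := (h z).1 (by
      intro φ
      have hφ : ∀ x, φ x = ∑ v, φ v * (Pi.single v 1 : V → ZMod 2) x := by
        intro x; simp [Pi.single_apply]
      have : ∀ e, z e * coboundary a b φ e =
          ∑ v, φ v * (z e * coboundary a b (Pi.single v 1) e) := by
        intro e
        unfold coboundary
        rw [hφ (a e), hφ (b e), ← Finset.sum_add_distrib, Finset.mul_sum]
        exact Finset.sum_congr rfl fun v _ => by ring
      simp only [this]
      rw [Finset.sum_comm]
      refine Finset.sum_eq_zero fun v _ => ?_
      rw [← Finset.mul_sum, hz', mul_zero])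
    refine ⟨fun f => g f, ?_⟩
    funext e
    rw [hg, hD]
    unfold coboundary
    by_cases hlr : l e = r e
    · rw [hlr, CharTwo.add_self_eq_zero, CharTwo.add_self_eq_zero]
    · have hl : l e ∈ properFaces l r := mem_properFaces.2 ⟨e, mem_faceBoundary.2 ⟨hlr, .inl rfl⟩⟩
      have hr : r e ∈ properFaces l r := mem_properFaces.2 ⟨e, mem_faceBoundary.2 ⟨hlr, .inr rfl⟩⟩
      simp [ext, hl, hr]
  let χ : I → LinearMap.ker D := fun i => ⟨fun f => if f.1 ∈ Φ i then 1 else 0, by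
    rw [LinearMap.mem_ker]
    funext e
    rw [hD, Pi.zero_apply, zmod_two_add_eq_zero]
    have : ∀ f, ext (fun f => if f.1 ∈ Φ i then 1 else 0) f = if f ∈ Φ i then 1 else 0 := by
      intro f
      simp only [ext]
      split_ifs with h1 h2 h2
      · rfl
      · rfl
      · exact absurd (hsub i h2) h1
      · rfl
    simp only [this, hcl i e]⟩
  have hχ : LinearIndependent (ZMod 2) χ := by
    apply LinearIndependent.of_comp (LinearMap.ker D).subtype
    rw [Fintype.linearIndependent_iff]
    intro c hc i
    obtain ⟨f, hf⟩ := hne i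
    have := congrFun hc ⟨f, hsub i hf⟩
    simp only [Finset.sum_apply, Pi.smul_apply, Function.comp, Submodule.subtype_apply, χ,
      smul_eq_mul, Pi.zero_apply] at this
    rw [Finset.sum_eq_single i] at this
    · simpa [hf] using this
    · intro j _ hji
      rw [if_neg fun hfj => hji (hdisj _ _ _ hfj hf), mul_zero]
    · simp
  have e1 := hχ.fintype_card_le_finrank
  have e2 := D.finrank_range_add_finrank_ker
  have e3 := M.finrank_range_add_finrank_ker
  have e4 := S.finrank_range_add_finrank_ker
  have e5 := Submodule.finrank_mono hSM
  have e6 := Submodule.finrank_mono hMD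
  rw [hS] at e4
  simp only [finrank_top, Module.finrank_self, Module.finrank_pi, Fintype.card_coe] at e2 e3 e4
  omega

section Counting

variable {V E F : Type*} [Fintype E] {a b : E → V} {l r : E → F}

open Classical in
/-- The boundary of a face is a cycle. -/
theorem IsDual.faceBoundary_cycle (h : IsDual a b l r) (f : F) :
    (∀ φ : V → ZMod 2, ∑ e, coboundary l r (fun g => if g = f then 1 else 0) e *
      coboundary a b φ e = 0) ∧
    ∀ e, coboundary l r (fun g => if g = f then 1 else 0) e ≠ 0 ↔ e ∈ faceBoundary l r f := by
  refine ⟨(h _).2 ⟨_, fun _ => rfl⟩, fun e => ?_⟩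
  rw [coboundary_indicator_ne_zero, mem_faceBoundary]
  grind

theorem IsDual.three_le_card_faceBoundary (h : IsDual a b l r) (hab : ∀ e, a e ≠ b e)
    (hinj : ∀ e e', s(a e, b e) = s(a e', b e') → e = e') {f : F} (hf : f ∈ properFaces l r) :
    3 ≤ (faceBoundary l r f).card := by
  obtain ⟨e, he⟩ := mem_properFaces.1 hf
  obtain ⟨h1, h2⟩ := h.faceBoundary_cycle f
  exact three_le_card_of_cycle hab hinj h1 ((h2 e).2 he) fun e => (h2 e).1

open Classical in
theorem card_filter_mem_faceBoundary_le (T : Finset F) (e : E) :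
    (T.filter fun f => e ∈ faceBoundary l r f).card ≤ 2 := by
  refine (Finset.card_le_card (t := {l e, r e}) ?_).trans Finset.card_le_two
  intro f hf
  have := (mem_faceBoundary.1 (Finset.mem_filter.1 hf).2).2
  simp only [Finset.mem_insert, Finset.mem_singleton]
  tauto

open Classical in
theorem sum_card_faceBoundary (T : Finset F) :
    ∑ f ∈ T, (faceBoundary l r f).card =
      ∑ e, (T.filter fun f => e ∈ faceBoundary l r f).card := by
  have := Finset.sum_card_bipartiteAbove_eq_sum_card_bipartiteBelow
    (s := T) (t := (Finset.univ : Finset E)) (fun f e => e ∈ faceBoundary l r f)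
  simpa [Finset.bipartiteAbove, Finset.bipartiteBelow] using this

theorem sum_card_faceBoundary_le (T : Finset F) :
    ∑ f ∈ T, (faceBoundary l r f).card ≤ 2 * Fintype.card E := by
  classical
  rw [sum_card_faceBoundary]
  refine (Finset.sum_le_sum fun e _ => card_filter_mem_faceBoundary_le T e).trans ?_
  simp [mul_comm]

/-- The usual bound `3 |V| - 6` for simple graphs with a dual, unless there is no face at all. -/
theorem IsDual.card_edges_le [Fintype V] [Nonempty V] (h : IsDual a b l r) (hab : ∀ e, a e ≠ b e)
    (hinj : ∀ e e', s(a e, b e) = s(a e', b e') → e = e') :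
    Fintype.card E + 6 ≤ 3 * Fintype.card V ∨ Fintype.card E + 1 ≤ Fintype.card V := by
  rcases (properFaces l r).eq_empty_or_nonempty with h0 | h0
  · right
    have := h.card_add_card_le (I := Empty) (fun i => i.elim) (fun i => i.elim)
      (fun i => i.elim) (fun i => i.elim) (fun i => i.elim)
    simpa [h0] using this
  · left
    have h1 := h.card_add_card_le (I := Unit) (fun _ => properFaces l r) (fun _ => subset_rfl)
      (fun _ => h0) (fun _ _ _ _ _ => rfl) (fun _ e => by
        by_cases hlr : l e = r e
        · rw [hlr]
        · exact iff_of_true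
            (mem_properFaces.2 ⟨e, mem_faceBoundary.2 ⟨hlr, .inl rfl⟩⟩)
            (mem_properFaces.2 ⟨e, mem_faceBoundary.2 ⟨hlr, .inr rfl⟩⟩))
    have h2 := sum_card_faceBoundary_le (l := l) (r := r) (properFaces l r)
    have h3 := Finset.card_nsmul_le_sum (properFaces l r) (fun f => (faceBoundary l r f).card) 3
      (fun f hf => h.three_le_card_faceBoundary hab hinj hf)
    simp only [Fintype.card_unit, smul_eq_mul] at h1 h3
    omega

end Counting

/-! ### Counting triangles among sets of size `k + 1` -/

/-- Three sets of size `k + 1` that meet pairwise in `k` elements either all meet in the same `k`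
elements or have pairwise the same union. -/
theorem subset_union_of_card_inter {α : Type*} [DecidableEq α] {k : ℕ} {x y z : Finset α}
    (hz : z.card = k + 1) (hxy : (x ∩ y).card = k)
    (hyz : (y ∩ z).card = k) (hxz : (x ∩ z).card = k)
    (hne : ¬ (x ∩ y = y ∩ z ∧ y ∩ z = x ∩ z)) : z ⊆ x ∪ y := by
  intro p hp
  by_contra hpxy
  simp only [Finset.mem_union, not_or] at hpxy
  have hcard : (z.erase p).card = k := by rw [Finset.card_erase_of_mem hp, hz]; rfl
  have h1 : x ∩ z = z.erase p := Finset.eq_of_subset_of_card_le (by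
    intro q hq
    rw [Finset.mem_inter] at hq
    exact Finset.mem_erase.2 ⟨fun h => hpxy.1 (h ▸ hq.1), hq.2⟩) (by omega)
  have h2 : y ∩ z = z.erase p := Finset.eq_of_subset_of_card_le (by
    intro q hq
    rw [Finset.mem_inter] at hq
    exact Finset.mem_erase.2 ⟨fun h => hpxy.2 (h ▸ hq.1), hq.2⟩) (by omega)
  have h3 : z.erase p = x ∩ y := Finset.eq_of_subset_of_card_le (by
    intro q hq
    rw [Finset.mem_inter]
    constructor
    · rw [← h1] at hq; exact (Finset.mem_inter.1 hq).1
    · rw [← h2] at hq; exact (Finset.mem_inter.1 hq).1) (by omega)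
  exact hne ⟨h3.symm.trans h2.symm, h2.trans h1.symm⟩

theorem card_union_of_card_inter {α V E : Type*} [DecidableEq α] {a b : E → V}
    {s : V → Finset α} {k : ℕ} (hs : ∀ v, (s v).card = k + 1)
    (hk : ∀ e, (s (a e) ∩ s (b e)).card = k) (e : E) : (s (a e) ∪ s (b e)).card = k + 2 := by
  have := Finset.card_union_add_card_inter (s (a e)) (s (b e))
  rw [hs, hs, hk] at this
  omega

section Labelled

variable {α V E F : Type*} [DecidableEq α] [Fintype E] {a b : E → V} {l r : E → F}
  {s : V → Finset α} {k : ℕ}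

/-- The edges of a triangle all have the same union of end sets. -/
theorem union_eq_of_mem_faceBoundary (h : IsDual a b l r) (hs : ∀ v, (s v).card = k + 1)
    (hab : ∀ e, a e ≠ b e) (hinj : ∀ e e', s(a e, b e) = s(a e', b e') → e = e')
    (hk : ∀ e, (s (a e) ∩ s (b e)).card = k)
    (htri : ∀ e₁ e₂ e₃ x y z, s(a e₁, b e₁) = s(x, y) → s(a e₂, b e₂) = s(y, z) →
      s(a e₃, b e₃) = s(x, z) → ¬ (s x ∩ s y = s y ∩ s z ∧ s y ∩ s z = s x ∩ s z))
    {f : F} (hf : (faceBoundary l r f).card = 3) {e e' : E} (he : e ∈ faceBoundary l r f)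
    (he' : e' ∈ faceBoundary l r f) : s (a e) ∪ s (b e) = s (a e') ∪ s (b e') := by
  obtain ⟨h1, h2⟩ := h.faceBoundary_cycle f
  obtain ⟨e₂, e₃, w, -, -, hw2, hw3, hall⟩ := exists_triangle_of_cycle hab hinj h1 h2 hf he
  have hU : ∀ e x y, s(a e, b e) = s(x, y) →
      s (a e) ∪ s (b e) = s x ∪ s y ∧ s (a e) ∩ s (b e) = s x ∩ s y := by
    intro e x y hxy
    rcases Sym2.eq_iff.1 hxy with ⟨rfl, rfl⟩ | ⟨rfl, rfl⟩
    · exact ⟨rfl, rfl⟩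
    · exact ⟨Finset.union_comm _ _, Finset.inter_comm _ _⟩
  have hsub : s w ⊆ s (a e) ∪ s (b e) :=
    subset_union_of_card_inter (hs _) (hk e) ((hU _ _ _ hw3).2 ▸ hk e₃)
      ((hU _ _ _ hw2).2 ▸ hk e₂) (htri e e₃ e₂ _ _ _ rfl hw3 hw2)
  have hc := card_union_of_card_inter hs hk
  rcases hall e' he' with rfl | rfl | rfl
  · rfl
  · refine (Finset.eq_of_subset_of_card_le ?_ ?_).symm
    · rw [(hU _ _ _ hw2).1]
      exact Finset.union_subset Finset.subset_union_left hsub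
    · rw [hc, hc]
  · refine (Finset.eq_of_subset_of_card_le ?_ ?_).symm
    · rw [(hU _ _ _ hw3).1]
      exact Finset.union_subset Finset.subset_union_right hsub
    · rw [hc, hc]

/-- At most `3 k` edges join two of the `k + 2` subsets of size `k + 1` of `ω`. -/
theorem IsDual.card_edges_union_eq_le [Fintype V] (h : IsDual a b l r) (hinjs : Function.Injective s)
    (hs : ∀ v, (s v).card = k + 1) (hk1 : 1 ≤ k)
    (hab : ∀ e, a e ≠ b e) (hinj : ∀ e e', s(a e, b e) = s(a e', b e') → e = e')
    {ω : Finset α} (hω : ω.card = k + 2) :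
    (Finset.univ.filter fun e => s (a e) ∪ s (b e) = ω).card ≤ 3 * k := by
  classical
  let V' := {v : V // s v ⊆ ω}
  let E' := {e : E // s (a e) ∪ s (b e) = ω}
  let a' : E' → V' := fun e => ⟨a e.1, Finset.subset_union_left.trans e.2.le⟩
  let b' : E' → V' := fun e => ⟨b e.1, Finset.subset_union_right.trans e.2.le⟩
  obtain ⟨F', l', r', h'⟩ := h.exists_minor a' b' Subtype.val Subtype.val_injective ∅
    (fun _ => id) (fun φ _ => ⟨fun v => φ v.1, fun _ => rfl⟩)
    (fun φ' => ⟨fun v => if hv : s v ⊆ ω then φ' ⟨v, hv⟩ else 0, by simp, fun e => by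
      simp only [coboundary]
      rw [dif_pos (a' e).2, dif_pos (b' e).2]⟩)
  have hV : Fintype.card V' ≤ k + 2 := by
    have h1 : Fintype.card V' ≤ (ω.powersetCard (k + 1)).card := by
      rw [← Finset.card_univ]
      apply Finset.card_le_card_of_injOn (fun v => s v.1)
      · intro v _
        simpa [Finset.mem_powersetCard, hs] using v.2
      · intro v _ w _ hvw
        exact Subtype.ext (hinjs hvw)
    rwa [Finset.card_powersetCard, hω, Nat.choose_succ_self_right] at h1
  rw [← Fintype.card_subtype]
  change Fintype.card E' ≤ 3 * k
  by_cases hE : Nonempty E'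
  · obtain ⟨e⟩ := hE
    have : Nonempty V' := ⟨a' e⟩
    have := h'.card_edges_le (fun e he => hab e.1 (congrArg Subtype.val he)) (fun e e' he =>
      Subtype.ext (hinj _ _ (congrArg (Sym2.map Subtype.val) he)))
    omega
  · rw [not_nonempty_iff] at hE
    simp

/-- The triangular faces that are formed by `(k + 1)`-subsets of `ω`. -/
noncomputable def triangleFaces (a b : E → V) (l r : E → F) (s : V → Finset α)
    (ω : Finset α) : Finset F := by
  classical exact (properFaces l r).filter fun f => (faceBoundary l r f).card = 3 ∧
    ∃ e ∈ faceBoundary l r f, s (a e) ∪ s (b e) = ω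

/-- The number of triangular faces at an edge. -/
noncomputable def triangleCount (l r : E → F) (e : E) : ℕ := by
  classical exact (((properFaces l r).filter fun f => (faceBoundary l r f).card = 3).filter
    fun f => e ∈ faceBoundary l r f).card

theorem triangleCount_le (e : E) : triangleCount l r e ≤ 2 :=
  card_filter_mem_faceBoundary_le _ e

/-- Among the edges with union `ω`, those on fewer than two triangles contain a nonzero cycle, so
there are at least three, unless there is no triangle in `ω` at all, or no edge separates the
triangles in `ω` from other faces. In the last case the constant `c` pays for the lack of such
edges. -/
theorem IsDual.card_add_sum_triangleCount_le [Fintype V] (h : IsDual a b l r)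
    (hinjs : Function.Injective s)
    (hs : ∀ v, (s v).card = k + 1) (hk1 : 1 ≤ k)
    (hab : ∀ e, a e ≠ b e) (hinj : ∀ e e', s(a e, b e) = s(a e', b e') → e = e')
    (hk : ∀ e, (s (a e) ∩ s (b e)).card = k)
    (htri : ∀ e₁ e₂ e₃ x y z, s(a e₁, b e₁) = s(x, y) → s(a e₂, b e₂) = s(y, z) →
      s(a e₃, b e₃) = s(x, z) → ¬ (s x ∩ s y = s y ∩ s z ∧ s y ∩ s z = s x ∩ s z))
    {ω : Finset α} (hω : ω.card = k + 2) {c : ℕ}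
    (hc : (triangleFaces a b l r s ω).Nonempty →
      (∀ e, l e ∈ triangleFaces a b l r s ω ↔ r e ∈ triangleFaces a b l r s ω) → 1 ≤ c) :
    (Finset.univ.filter fun e => s (a e) ∪ s (b e) = ω).card +
        k * ∑ e with s (a e) ∪ s (b e) = ω, triangleCount l r e ≤
      2 * k * (Finset.univ.filter fun e => s (a e) ∪ s (b e) = ω).card + 12 * k * c := by
  classical
  set Eω := Finset.univ.filter fun e => s (a e) ∪ s (b e) = ω with hEω
  set Φ := triangleFaces a b l r s ω with hΦ
  have hE3 : Eω.card ≤ 3 * k := h.card_edges_union_eq_le hinjs hs hk1 hab hinj hω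
  have ht2 : ∑ e ∈ Eω, triangleCount l r e ≤ 2 * Eω.card := by
    refine (Finset.sum_le_sum fun e _ => triangleCount_le e).trans ?_
    simp [mul_comm]
  have hmemΦ : ∀ {f e}, e ∈ faceBoundary l r f →
      (f ∈ Φ ↔ (faceBoundary l r f).card = 3 ∧ e ∈ Eω) := by
    intro f e he
    simp only [hΦ, triangleFaces, Finset.mem_filter, hEω, Finset.mem_univ, true_and]
    constructor
    · rintro ⟨-, h3, e', he', rfl⟩
      exact ⟨h3, union_eq_of_mem_faceBoundary h hs hab hinj hk htri h3 he he'⟩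
    · rintro ⟨h3, heω⟩
      exact ⟨mem_properFaces.2 ⟨e, he⟩, h3, e, he, heω⟩
  by_cases hcl : ∀ e, l e ∈ Φ ↔ r e ∈ Φ
  · rcases Φ.eq_empty_or_nonempty with h0 | h0
    · have ht : ∑ e ∈ Eω, triangleCount l r e = 0 := by
        refine Finset.sum_eq_zero fun e he => ?_
        rw [triangleCount, Finset.card_eq_zero, Finset.filter_filter]
        refine Finset.filter_eq_empty_iff.2 fun f _ hf' => ?_
        have : f ∈ Φ := (hmemΦ hf'.2).2 ⟨hf'.1, he⟩
        rw [h0] at this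
        simp at this
      rw [ht]
      nlinarith
    · have := hc h0 hcl
      nlinarith
  · rw [not_forall] at hcl
    obtain ⟨e₀, he₀⟩ := hcl
    set z : E → ZMod 2 := coboundary l r (fun f => if f ∈ Φ then 1 else 0) with hz
    have hzne : ∀ e, z e ≠ 0 → e ∈ Eω ∧ triangleCount l r e ≤ 1 := by
      intro e he
      rw [hz, coboundary_indicator_ne_zero] at he
      have hlr : l e ≠ r e := fun hlr => he (by rw [hlr])
      have hl : e ∈ faceBoundary l r (l e) := mem_faceBoundary.2 ⟨hlr, .inl rfl⟩
      have hr : e ∈ faceBoundary l r (r e) := mem_faceBoundary.2 ⟨hlr, .inr rfl⟩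
      rw [hmemΦ hl, hmemΦ hr] at he
      have heω : e ∈ Eω := by
        by_contra hh
        exact he (by simp [hh])
      refine ⟨heω, ?_⟩
      rw [triangleCount, Finset.card_le_one]
      intro f hf g hg
      simp only [Finset.mem_filter] at hf hg
      have hf' := (mem_faceBoundary.1 hf.2).2
      have hg' := (mem_faceBoundary.1 hg.2).2
      rcases hf' with rfl | rfl <;> rcases hg' with rfl | rfl
      · rfl
      · exact absurd (iff_of_true ⟨hf.1.2, heω⟩ ⟨hg.1.2, heω⟩) he
      · exact absurd (iff_of_true ⟨hg.1.2, heω⟩ ⟨hf.1.2, heω⟩) he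
      · rfl
    have hcyc := (h z).2 ⟨_, fun _ => rfl⟩
    have h3 : 3 ≤ (Eω.filter fun e => triangleCount l r e ≤ 1).card :=
      three_le_card_of_cycle hab hinj hcyc (e := e₀)
        (by rw [hz, coboundary_indicator_ne_zero]; exact he₀)
        (fun e he => Finset.mem_filter.2 (hzne e he))
    have ht : ∑ e ∈ Eω, triangleCount l r e + 3 ≤ 2 * Eω.card := by
      have : ∑ e ∈ Eω, (triangleCount l r e + if triangleCount l r e ≤ 1 then 1 else 0) ≤
          ∑ e ∈ Eω, 2 := Finset.sum_le_sum fun e _ => by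
        have := triangleCount_le (l := l) (r := r) e
        split_ifs <;> omega
      rw [Finset.sum_add_distrib, ← Finset.card_filter, Finset.sum_const, smul_eq_mul] at this
      omega
    nlinarith

/-- The sharpening of the bound `3 |V|` for a planar graph whose vertices are `(k + 1)`-sets, where
adjacent vertices share `k` elements, and no triangle has all its vertices around the same
`k`-set. -/
theorem IsDual.mul_card_edges_le [Fintype V] [Nonempty V] (h : IsDual a b l r)
    (hinjs : Function.Injective s)
    (hs : ∀ v, (s v).card = k + 1) (hk1 : 1 ≤ k)
    (hab : ∀ e, a e ≠ b e) (hinj : ∀ e e', s(a e, b e) = s(a e', b e') → e = e')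
    (hk : ∀ e, (s (a e) ∩ s (b e)).card = k)
    (htri : ∀ e₁ e₂ e₃ x y z, s(a e₁, b e₁) = s(x, y) → s(a e₂, b e₂) = s(y, z) →
      s(a e₃, b e₃) = s(x, z) → ¬ (s x ∩ s y = s y ∩ s z ∧ s y ∩ s z = s x ∩ s z)) :
    (4 * k + 1) * Fintype.card E ≤ 12 * k * Fintype.card V := by
  classical
  set Ω : Finset (Finset α) := Finset.univ.image fun e => s (a e) ∪ s (b e) with hΩ
  -- The `ω` whose triangles form a union of components of the dual graph.
  set C := Ω.filter fun ω => (triangleFaces a b l r s ω).Nonempty ∧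
    ∀ e, l e ∈ triangleFaces a b l r s ω ↔ r e ∈ triangleFaces a b l r s ω with hC
  have hmaps : ∀ e ∈ (Finset.univ : Finset E), s (a e) ∪ s (b e) ∈ Ω := fun e he =>
    Finset.mem_image_of_mem _ he
  have heuler := h.card_add_card_le (I := C) (fun ω => triangleFaces a b l r s ω.1)
    (fun ω => Finset.filter_subset _ _) (fun ω => (Finset.mem_filter.1 ω.2).2.1)
    (fun ω ω' f hf hf' => by
      obtain ⟨-, h3, e, he, heω⟩ := Finset.mem_filter.1 hf
      obtain ⟨-, -, e', he', heω'⟩ := Finset.mem_filter.1 hf'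
      apply Subtype.ext
      rw [← heω, ← heω']
      exact union_eq_of_mem_faceBoundary h hs hab hinj hk htri h3 he he')
    (fun ω => (Finset.mem_filter.1 ω.2).2.2)
  rw [Fintype.card_coe] at heuler
  -- A triangle has weight `9 + 3`, any other face weight at least `3 * 4`.
  have hfaces : 12 * (properFaces l r).card ≤
      6 * Fintype.card E + ∑ e, triangleCount l r e := by
    have h1 : ∑ e, triangleCount l r e = ∑ f ∈ properFaces l r,
        if (faceBoundary l r f).card = 3 then (faceBoundary l r f).card else 0 := by
      rw [← Finset.sum_filter, sum_card_faceBoundary]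
      rfl
    have h2 : ∑ f ∈ properFaces l r, 12 ≤ ∑ f ∈ properFaces l r, (3 * (faceBoundary l r f).card +
        if (faceBoundary l r f).card = 3 then (faceBoundary l r f).card else 0) :=
      Finset.sum_le_sum fun f hf => by
        have := h.three_le_card_faceBoundary hab hinj hf
        split_ifs <;> omega
    have h3 := sum_card_faceBoundary_le (l := l) (r := r) (properFaces l r)
    rw [Finset.sum_add_distrib, ← h1, ← Finset.mul_sum, Finset.sum_const, smul_eq_mul] at h2
    omega
  have hE : Fintype.card E =
      ∑ ω ∈ Ω, (Finset.univ.filter fun e => s (a e) ∪ s (b e) = ω).card := by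
    rw [← Finset.card_univ]
    exact Finset.card_eq_sum_card_fiberwise hmaps
  have ht : ∑ e, triangleCount l r e =
      ∑ ω ∈ Ω, ∑ e with s (a e) ∪ s (b e) = ω, triangleCount l r e :=
    (Finset.sum_fiberwise_of_maps_to hmaps _).symm
  have hsum : Fintype.card E + k * ∑ e, triangleCount l r e ≤
      2 * k * Fintype.card E + 12 * k * C.card := by
    rw [ht, hE, Finset.mul_sum, ← Finset.sum_add_distrib, hC, Finset.card_filter, Finset.mul_sum,
      Finset.mul_sum, ← Finset.sum_add_distrib]
    refine Finset.sum_le_sum fun ω hω => ?_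
    obtain ⟨e, -, rfl⟩ := Finset.mem_image.1 hω
    refine h.card_add_sum_triangleCount_le hinjs hs hk1 hab hinj hk htri
      (card_union_of_card_inter hs hk e) fun h1 h2 => ?_
    rw [if_pos ⟨h1, h2⟩]
  nlinarith

end Labelled

/-! ### Connected sets of vertices and the tree minor -/

/-- Connectedness of the subgraph induced on a set `C` of vertices: a predicate that is constant
along its edges is constant. -/
def IsLinked {V E : Type*} (a b : E → V) (C : Set V) : Prop :=
  ∀ p : V → Prop, (∀ e, a e ∈ C → b e ∈ C → (p (a e) ↔ p (b e))) → ∀ u ∈ C, ∀ v ∈ C, p u → p v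

section Linked

variable {V E : Type*} {a b : E → V}

theorem IsLinked.exists_edge {C : Set V} (h : IsLinked a b C) (p : V → Prop) {u v : V}
    (hu : u ∈ C) (hv : v ∈ C) (hpu : p u) (hpv : ¬ p v) :
    ∃ e, a e ∈ C ∧ b e ∈ C ∧ ¬ (p (a e) ↔ p (b e)) := by
  by_contra! hcon
  exact hpv (h p (fun e ha hb => by have := hcon e ha hb; tauto) u hu v hv hpu)

theorem IsLinked.insert {C : Set V} (h : IsLinked a b C) {u v : V} (hu : u ∈ C) {e : E}
    (he : s(a e, b e) = s(u, v)) : IsLinked a b (insert v C) := by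
  intro p hp
  have huv : p u ↔ p v := by
    rcases Sym2.eq_iff.1 he with ⟨rfl, rfl⟩ | ⟨rfl, rfl⟩
    · exact hp e (Set.mem_insert_of_mem _ hu) (Set.mem_insert _ _)
    · exact (hp e (Set.mem_insert _ _) (Set.mem_insert_of_mem _ hu)).symm
  have hC := h p fun e ha hb => hp e (Set.mem_insert_of_mem _ ha) (Set.mem_insert_of_mem _ hb)
  have key : ∀ x ∈ Insert.insert v C, p x ↔ p u := by
    rintro x (rfl | hx)
    · exact huv.symm
    · exact ⟨hC x hx u hu, hC u hu x hx⟩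
  intro x hx y hy hpx
  exact (key y hy).2 ((key x hx).1 hpx)

/-- Disjoint connected sets `C σ` can be enlarged so that they cover connected sets `D τ` which
overlap only inside the `C σ`. -/
theorem exists_linked_cover {S T : Type*} (inc : T → S → Prop) (C : S → Set V) (D : T → Set V)
    (hC : ∀ σ, IsLinked a b (C σ)) (hCC : ∀ σ σ' v, v ∈ C σ → v ∈ C σ' → σ = σ')
    (hD : ∀ τ, IsLinked a b (D τ)) (hfin : (⋃ τ, D τ).Finite)
    (hDC : ∀ τ σ v, v ∈ D τ → v ∈ C σ → inc τ σ)
    (hDD : ∀ τ τ' v, τ ≠ τ' → v ∈ D τ → v ∈ D τ' → ∃ σ, v ∈ C σ)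
    (hne : ∀ τ, ∃ σ v, v ∈ D τ ∧ v ∈ C σ) :
    ∃ C' : S → Set V, (∀ σ, C σ ⊆ C' σ) ∧ (∀ σ, IsLinked a b (C' σ)) ∧
      (∀ σ σ' v, v ∈ C' σ → v ∈ C' σ' → σ = σ') ∧
      (∀ τ σ v, v ∈ D τ → v ∈ C' σ → inc τ σ) ∧ ∀ τ, ∀ v ∈ D τ, ∃ σ, v ∈ C' σ := by
  classical
  suffices H : ∀ (m : ℕ) (C' : S → Set V), {v ∈ ⋃ τ, D τ | ∀ σ, v ∉ C' σ}.ncard = m →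
      (∀ σ, C σ ⊆ C' σ) → (∀ σ, IsLinked a b (C' σ)) →
      (∀ σ σ' v, v ∈ C' σ → v ∈ C' σ' → σ = σ') →
      (∀ τ σ v, v ∈ D τ → v ∈ C' σ → inc τ σ) →
      ∃ C' : S → Set V, (∀ σ, C σ ⊆ C' σ) ∧ (∀ σ, IsLinked a b (C' σ)) ∧
        (∀ σ σ' v, v ∈ C' σ → v ∈ C' σ' → σ = σ') ∧
        (∀ τ σ v, v ∈ D τ → v ∈ C' σ → inc τ σ) ∧ ∀ τ, ∀ v ∈ D τ, ∃ σ, v ∈ C' σ from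
    H _ C rfl (fun _ => subset_rfl) hC hCC hDC
  intro m
  induction m using Nat.strong_induction_on with
  | _ m ih =>
  intro C' hm h1 h2 h3 h4
  by_cases hcov : ∀ τ, ∀ v ∈ D τ, ∃ σ, v ∈ C' σ
  · exact ⟨C', h1, h2, h3, h4, hcov⟩
  push Not at hcov
  obtain ⟨τ, v, hv, hvC⟩ := hcov
  obtain ⟨σ₀, v₀, hv₀, hv₀C⟩ := hne τ
  obtain ⟨e, hea, heb, he⟩ := (hD τ).exists_edge (fun x => ∃ σ, x ∈ C' σ) hv₀ hv
    ⟨σ₀, h1 _ hv₀C⟩ (fun ⟨σ, hσ⟩ => hvC σ hσ)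
  obtain ⟨u, w, huw, hu, hw, ⟨σ, hσ⟩, hwC⟩ : ∃ u w, s(a e, b e) = s(u, w) ∧ u ∈ D τ ∧ w ∈ D τ ∧
      (∃ σ, u ∈ C' σ) ∧ ¬ ∃ σ, w ∈ C' σ := by
    by_cases ha : ∃ σ, a e ∈ C' σ
    · exact ⟨a e, b e, rfl, hea, heb, ha, fun hb => he (iff_of_true ha hb)⟩
    · by_cases hb : ∃ σ, b e ∈ C' σ
      · exact ⟨b e, a e, Sym2.eq_swap, heb, hea, hb, ha⟩
      · exact absurd (iff_of_false ha hb) he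
  have hwC' : ∀ σ, w ∉ C' σ := fun σ h => hwC ⟨σ, h⟩
  let C'' : S → Set V := Function.update C' σ (insert w (C' σ))
  have hmem : ∀ {ρ x}, x ∈ C'' ρ ↔ x ∈ C' ρ ∨ (x = w ∧ ρ = σ) := by
    intro ρ x
    by_cases hρ : ρ = σ
    · subst hρ
      simp [C'', or_comm]
    · simp [C'', hρ]
  refine ih _ ?_ C'' rfl ?_ ?_ ?_ ?_
  · rw [← hm]
    apply Set.ncard_lt_ncard _ (hfin.subset fun x hx => hx.1)
    refine ⟨fun x hx => ⟨hx.1, fun ρ hρ => hx.2 ρ (hmem.2 (.inl hρ))⟩, fun hsub => ?_⟩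
    exact (hsub ⟨Set.mem_iUnion.2 ⟨τ, hw⟩, hwC'⟩).2 σ (hmem.2 (.inr ⟨rfl, rfl⟩))
  · exact fun ρ x hx => hmem.2 (.inl (h1 ρ hx))
  · intro ρ
    by_cases hρ : ρ = σ
    · subst hρ
      simpa [C''] using (h2 ρ).insert hσ huw
    · simpa [C'', hρ] using h2 ρ
  · intro ρ ρ' x hx hx'
    rcases hmem.1 hx with h | ⟨h, rfl⟩ <;> rcases hmem.1 hx' with h' | ⟨h', rfl⟩
    · exact h3 _ _ _ h h'
    · exact absurd (h' ▸ h) (hwC' _)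
    · exact absurd (h ▸ h') (hwC' _)
    · rfl
  · intro τ' ρ x hx hxρ
    rcases hmem.1 hxρ with hxρ | ⟨rfl, rfl⟩
    · exact h4 _ _ _ hx hxρ
    · by_cases hτ : τ' = τ
      · rw [hτ]
        exact h4 _ _ _ hu hσ
      · obtain ⟨σ', hσ'⟩ := hDD _ _ _ hτ hx hw
        exact absurd (h1 _ hσ') (hwC' _)

/-- Contraction of the connected sets of `exists_linked_cover`, keeping for every `τ` a spanning
tree of the graph that `D τ` induces on the indices `σ` incident with `τ`. -/
theorem IsDual.exists_tree_minor {S T F : Type} [Fintype E] [Fintype S] [Fintype T] {l r : E → F}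
    (h : IsDual a b l r)
    (inc : T → S → Prop) [∀ τ, DecidablePred (inc τ)] (C : S → Set V) (D : T → Set V)
    (hC : ∀ σ, IsLinked a b (C σ)) (hCne : ∀ σ, (C σ).Nonempty)
    (hCC : ∀ σ σ' v, v ∈ C σ → v ∈ C σ' → σ = σ')
    (hD : ∀ τ, IsLinked a b (D τ))
    (hDC : ∀ τ σ v, v ∈ D τ → v ∈ C σ → inc τ σ)
    (hcov : ∀ τ, ∀ v ∈ D τ, ∃ σ, v ∈ C σ)
    (hne : ∀ τ σ, inc τ σ → ∃ v, v ∈ D τ ∧ v ∈ C σ) (hne' : ∀ τ, ∃ σ, inc τ σ)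
    (hinc : ∀ τ τ' σ σ', σ ≠ σ' → inc τ σ → inc τ σ' → inc τ' σ → inc τ' σ' → τ = τ') :
    ∃ (E' : Type) (_ : Fintype E') (F' : Type) (a' b' : E' → S) (l' r' : E' → F') (lab : E' → T),
      IsDual a' b' l' r' ∧ (∀ e, a' e ≠ b' e) ∧
      (∀ e e', s(a' e, b' e) = s(a' e', b' e') → e = e') ∧
      (∀ e, inc (lab e) (a' e) ∧ inc (lab e) (b' e)) ∧
      (∀ e₁ e₂ e₃ x y z, s(a' e₁, b' e₁) = s(x, y) → s(a' e₂, b' e₂) = s(y, z) →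
        s(a' e₃, b' e₃) = s(x, z) → ¬ (lab e₁ = lab e₂ ∧ lab e₂ = lab e₃)) ∧
      Fintype.card E' + Fintype.card T = ∑ τ, Fintype.card {σ // inc τ σ} := by
  classical
  let G : ∀ τ, SimpleGraph {σ // inc τ σ} := fun τ =>
    { Adj := fun σ σ' => σ ≠ σ' ∧ ∃ e, (a e ∈ C σ.1 ∧ b e ∈ C σ'.1) ∨ (a e ∈ C σ'.1 ∧ b e ∈ C σ.1)
      symm := ⟨fun σ σ' hσ => ⟨hσ.1.symm, hσ.2.imp fun e he => he.symm⟩⟩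
      loopless := ⟨fun σ hσ => hσ.1 rfl⟩ }
  have hG : ∀ τ, (G τ).Connected := by
    intro τ
    have : Nonempty {σ // inc τ σ} := (hne' τ).elim fun σ hσ => ⟨⟨σ, hσ⟩⟩
    refine SimpleGraph.Connected.mk fun σ σ' => ?_
    obtain ⟨u, hu, huC⟩ := hne τ σ.1 σ.2
    obtain ⟨v, hv, hvC⟩ := hne τ σ'.1 σ'.2
    obtain ⟨ρ, hρ, hvρ⟩ := hD τ (fun x => ∃ ρ, (G τ).Reachable σ ρ ∧ x ∈ C ρ.1) (by
      have key : ∀ x y (ρ : {σ // inc τ σ}), y ∈ D τ → (G τ).Reachable σ ρ → x ∈ C ρ.1 →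
          (∃ e, s(a e, b e) = s(x, y)) → ∃ ρ, (G τ).Reachable σ ρ ∧ y ∈ C ρ.1 := by
        rintro x y ρ hy hρ hx ⟨e, he⟩
        obtain ⟨ρ', hρ'⟩ := hcov τ y hy
        by_cases heq : ρ = ⟨ρ', hDC _ _ _ hy hρ'⟩
        · exact ⟨ρ, hρ, by rw [heq]; exact hρ'⟩
        · refine ⟨⟨ρ', hDC _ _ _ hy hρ'⟩, hρ.trans (SimpleGraph.Adj.reachable ⟨heq, e, ?_⟩), hρ'⟩
          rcases Sym2.eq_iff.1 he with ⟨rfl, rfl⟩ | ⟨rfl, rfl⟩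
          · exact .inl ⟨hx, hρ'⟩
          · exact .inr ⟨hρ', hx⟩
      intro e ha hb
      constructor
      · rintro ⟨ρ, h1, h2⟩
        exact key _ _ ρ hb h1 h2 ⟨e, rfl⟩
      · rintro ⟨ρ, h1, h2⟩
        exact key _ _ ρ ha h1 h2 ⟨e, Sym2.eq_swap⟩) u hu v hv ⟨σ, .rfl, huC⟩
    rwa [Subtype.ext (hCC _ _ _ hvC hvρ)]
  choose t htG ht using fun τ => (hG τ).exists_isTree_le
  let E' := Σ τ, (t τ).edgeSet
  have hE' : ∀ x : E', ∃ (e : E) (p q : {σ // inc x.1 σ}), x.2.1 = s(p, q) ∧ p ≠ q ∧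
      a e ∈ C p.1 ∧ b e ∈ C q.1 := by
    rintro ⟨τ, ε, hε⟩
    induction ε with
    | _ p q =>
      obtain ⟨hpq, e, he | he⟩ := htG τ ((SimpleGraph.mem_edgeSet _).1 hε)
      · exact ⟨e, p, q, rfl, hpq, he⟩
      · exact ⟨e, q, p, Sym2.eq_swap, hpq.symm, he⟩
  choose ι p q hpq hne_pq hιp hιq using hE'
  have hpq1 : ∀ x, (p x).1 ≠ (q x).1 := fun x hx => hne_pq x (Subtype.ext hx)
  -- An edge of a tree is determined by its ends, since these determine `τ`.
  have hinj' : ∀ x y : E', s((p x).1, (q x).1) = s((p y).1, (q y).1) → x = y := by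
    intro x y hxy
    have hτ : x.1 = y.1 := by
      rcases Sym2.eq_iff.1 hxy with ⟨h1, h2⟩ | ⟨h1, h2⟩
      · exact hinc _ _ _ _ (hpq1 x) (p x).2 (q x).2 (h1 ▸ (p y).2) (h2 ▸ (q y).2)
      · exact hinc _ _ _ _ (hpq1 x) (p x).2 (q x).2 (h1 ▸ (q y).2) (h2 ▸ (p y).2)
    have h1 := hpq x
    have h2 := hpq y
    generalize p x = px, q x = qx, p y = py, q y = qy at *
    obtain ⟨τ, ε⟩ := x
    obtain ⟨τ', ε'⟩ := y
    obtain rfl : τ = τ' := hτ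
    have : ε.1 = ε'.1 := by
      rw [h1, h2]
      exact Sym2.map.injective Subtype.val_injective hxy
    rw [Subtype.ext this]
  have hCadj : ∀ {φ : V → ZMod 2} {σ x y}, (∀ e ∈ {e | ∃ σ, a e ∈ C σ ∧ b e ∈ C σ},
      coboundary a b φ e = 0) → x ∈ C σ → y ∈ C σ → φ x = φ y := by
    intro φ σ x y hφ hx hy
    refine (hC σ (fun v => φ v = φ y) (fun e ha hb => ?_) y hy x hx rfl)
    rw [zmod_two_add_eq_zero.1 (hφ e ⟨σ, ha, hb⟩)]
  obtain ⟨F', l', r', h'⟩ := h.exists_minor (V' := S) (E' := E') (fun x => (p x).1)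
    (fun x => (q x).1) ι
    (fun x y hxy => hinj' x y (by
      rw [hCC _ _ _ (hιp x) (hxy ▸ hιp y), hCC _ _ _ (hιq x) (hxy ▸ hιq y)]))
    {e | ∃ σ, a e ∈ C σ ∧ b e ∈ C σ}
    (fun x ⟨σ, h1, h2⟩ => hpq1 x ((hCC _ _ _ (hιp x) h1).trans (hCC _ _ _ h2 (hιq x))))
    (fun φ hφ => ⟨fun σ => φ (hCne σ).some, fun x => by
      simp only [coboundary]
      rw [hCadj hφ (hCne _).some_mem (hιp x), hCadj hφ (hCne _).some_mem (hιq x)]⟩)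
    (fun φ' => by
      let φ : V → ZMod 2 := fun v => if hv : ∃ σ, v ∈ C σ then φ' hv.choose else 0
      have hφ : ∀ {v σ}, v ∈ C σ → φ v = φ' σ := by
        intro v σ hv
        have hv' : ∃ σ, v ∈ C σ := ⟨σ, hv⟩
        simp only [φ, dif_pos hv']
        rw [hCC _ _ _ hv'.choose_spec hv]
      refine ⟨φ, ?_, fun x => ?_⟩
      · rintro e ⟨σ, h1, h2⟩
        rw [coboundary, hφ h1, hφ h2, CharTwo.add_self_eq_zero]
      · rw [coboundary, coboundary, hφ (hιp x), hφ (hιq x)])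
  refine ⟨E', inferInstance, F', _, _, l', r', Sigma.fst, ?_, hpq1, hinj',
    fun x => ⟨(p x).2, (q x).2⟩, ?_, ?_⟩
  · exact h'
  · rintro x₁ x₂ x₃ u v w h1 h2 h3 ⟨h12, h23⟩
    have hadj : ∀ (τ : T) (x : E'), x.1 = τ → ∀ {u v}, s((p x).1, (q x).1) = s(u, v) →
        ∃ (hu : inc τ u) (hv : inc τ v), (t τ).Adj ⟨u, hu⟩ ⟨v, hv⟩ := by
      rintro _ x rfl u v hx
      have hε := x.2.2
      rw [hpq x] at hε
      rcases Sym2.eq_iff.1 hx with ⟨rfl, rfl⟩ | ⟨rfl, rfl⟩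
      · exact ⟨(p x).2, (q x).2, hε⟩
      · exact ⟨(q x).2, (p x).2, SimpleGraph.Adj.symm hε⟩
    obtain ⟨hu, hv, huv⟩ := hadj x₃.1 x₁ (h12.trans h23) h1
    obtain ⟨_, hw, hvw⟩ := hadj x₃.1 x₂ h23 h2
    obtain ⟨_, _, huw⟩ := hadj x₃.1 x₃ rfl h3
    obtain ⟨_, c, hc, -⟩ := SimpleGraph.is3Clique_iff_exists_cycle_length_three.1
      ⟨_, SimpleGraph.is3Clique_triple_iff.2 ⟨huv, huw, hvw⟩⟩
    exact (ht _).isAcyclic c hc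
  · have hcard : ∀ τ, Fintype.card (t τ).edgeSet + 1 = Fintype.card {σ // inc τ σ} := fun τ => by
      rw [← (ht τ).card_edgeFinset, SimpleGraph.edgeFinset_card]
    rw [← Finset.sum_congr rfl fun τ _ => hcard τ, Finset.sum_add_distrib, Finset.sum_const,
      Finset.card_univ, smul_eq_mul, mul_one, ← Fintype.card_sigma]

end Linked

/-! ### From planar regions to a grid -/

open Topology

/-- The grid points within distance less than `1`, in both coordinates `u` and `v`, of a point
of `K`. -/
def gridNear {X : Type*} (u v : X → ℝ) (K : Set X) : Set (ℕ × ℕ) :=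
  {p | ∃ x ∈ K, |u x - p.1| < 1 ∧ |v x - p.2| < 1}

theorem eq_floor_or_of_abs_sub_lt {x : ℝ} (hx : 0 ≤ x) {i : ℕ} (h : |x - i| < 1) :
    i = ⌊x⌋₊ ∨ i = ⌊x⌋₊ + 1 := by
  rw [abs_lt] at h
  have h1 := Nat.floor_le hx
  have h2 := Nat.lt_floor_add_one x
  have h3 : i < ⌊x⌋₊ + 2 := by
    have : (i : ℝ) < (⌊x⌋₊ + 2 : ℕ) := by push_cast; linarith
    exact_mod_cast this
  have h4 : ⌊x⌋₊ < i + 1 := by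
    have : (⌊x⌋₊ : ℝ) < (i + 1 : ℕ) := by push_cast; linarith
    exact_mod_cast this
  omega

theorem abs_sub_floor_lt {x : ℝ} (hx : 0 ≤ x) : |x - ⌊x⌋₊| < 1 := by
  have h1 := Nat.floor_le hx
  have h2 := Nat.lt_floor_add_one x
  rw [abs_lt]
  constructor <;> linarith

theorem isLinked_gridNear {X : Type*} [TopologicalSpace X] {u v : X → ℝ} (hu : Continuous u)
    (hv : Continuous v) {K : Set X} (hK : IsPreconnected K) {N : ℕ}
    (hu0 : ∀ x ∈ K, 0 ≤ u x) (hv0 : ∀ x ∈ K, 0 ≤ v x)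
    (huN : ∀ x ∈ K, u x + 1 ≤ N) (hvN : ∀ x ∈ K, v x + 1 ≤ N) :
    IsLinked (gridFst (N := N)) gridSnd (gridNear u v K) := by
  classical
  intro p hp
  have hlt : ∀ {t : ℝ} {i : ℕ}, t + 1 ≤ N → |t - i| < 1 → i < N := by
    intro t i ht hi
    rw [abs_lt] at hi
    have : (i : ℝ) < N := by linarith
    exact_mod_cast this
  have hh : ∀ x ∈ K, ∀ i j : ℕ, |u x - i| < 1 → |u x - (i + 1 : ℕ)| < 1 → |v x - j| < 1 →
      (p (i, j) ↔ p (i + 1, j)) := fun x hx i j h1 h2 h3 =>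
    hp (⟨i, hlt (huN x hx) h1⟩, ⟨j, hlt (hvN x hx) h3⟩, false) ⟨x, hx, h1, h3⟩ ⟨x, hx, h2, h3⟩
  have hw : ∀ x ∈ K, ∀ i j : ℕ, |u x - i| < 1 → |v x - j| < 1 → |v x - (j + 1 : ℕ)| < 1 →
      (p (i, j) ↔ p (i, j + 1)) := fun x hx i j h1 h2 h3 =>
    hp (⟨i, hlt (huN x hx) h1⟩, ⟨j, hlt (hvN x hx) h2⟩, true) ⟨x, hx, h1, h2⟩ ⟨x, hx, h1, h3⟩
  -- The grid points near a point `x` of `K` all agree with the lower left one.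
  have key : ∀ x ∈ K, ∀ i j : ℕ, |u x - i| < 1 → |v x - j| < 1 →
      (p (i, j) ↔ p (⌊u x⌋₊, ⌊v x⌋₊)) := by
    intro x hx i j hi hj
    have fu := abs_sub_floor_lt (hu0 x hx)
    have fv := abs_sub_floor_lt (hv0 x hx)
    have h1 : p (i, j) ↔ p (i, ⌊v x⌋₊) := by
      rcases eq_floor_or_of_abs_sub_lt (hv0 x hx) hj with rfl | rfl
      · rfl
      · exact (hw x hx _ _ hi fv hj).symm
    have h2 : p (i, ⌊v x⌋₊) ↔ p (⌊u x⌋₊, ⌊v x⌋₊) := by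
      rcases eq_floor_or_of_abs_sub_lt (hu0 x hx) hi with rfl | rfl
      · rfl
      · exact (hh x hx _ _ fu hi fv).symm
    exact h1.trans h2
  let f : X → Bool := fun x => decide (p (⌊u x⌋₊, ⌊v x⌋₊))
  have hf : ContinuousOn f K := by
    intro x hx
    apply ContinuousWithinAt.congr_of_eventuallyEq (f := fun _ => f x)
      continuousWithinAt_const _ rfl
    have h1 : ∀ᶠ y in 𝓝[K] x, |u y - ⌊u x⌋₊| < 1 :=
      ((hu.sub continuous_const).abs.continuousAt.eventually_lt continuousAt_const
        (abs_sub_floor_lt (hu0 x hx))).filter_mono nhdsWithin_le_nhds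
    have h2 : ∀ᶠ y in 𝓝[K] x, |v y - ⌊v x⌋₊| < 1 :=
      ((hv.sub continuous_const).abs.continuousAt.eventually_lt continuousAt_const
        (abs_sub_floor_lt (hv0 x hx))).filter_mono nhdsWithin_le_nhds
    filter_upwards [h1, h2, self_mem_nhdsWithin] with y h1 h2 hy
    simp only [f, key y hy _ _ h1 h2]
  rintro ⟨i, j⟩ ⟨x, hx, hi, hj⟩ ⟨i', j'⟩ ⟨y, hy, hi', hj'⟩ hpx
  have hxy := hK.constant hf hx hy
  rw [key x hx i j hi hj] at hpx
  rw [key y hy i' j' hi' hj']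
  exact (decide_eq_decide.1 hxy).1 hpx

/-- A compact subset of an open path-connected set lies in the interior of a compact connected
subset. -/
theorem exists_isCompact_isPreconnected {X : Type*} [NormedAddCommGroup X] [NormedSpace ℝ X]
    [ProperSpace X] {W Q : Set X} (hW : IsOpen W) (hWc : IsPathConnected W) (hQ : IsCompact Q)
    (hQW : Q ⊆ W) : ∃ K, IsCompact K ∧ IsPreconnected K ∧ Q ⊆ interior K ∧ K ⊆ W := by
  obtain ⟨w, hw, hjoin⟩ := hWc
  have hM : ∀ x ∈ Q, ∃ M, IsCompact M ∧ IsPreconnected M ∧ M ⊆ W ∧ w ∈ M ∧ x ∈ interior M := by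
    intro x hx
    have hj := hjoin (hQW hx)
    obtain ⟨ε, hε, hball⟩ := Metric.nhds_basis_closedBall.mem_iff.1 (hW.mem_nhds (hQW hx))
    refine ⟨Set.range hj.somePath ∪ Metric.closedBall x ε, (isCompact_range
      hj.somePath.continuous).union (isCompact_closedBall x ε), ?_, ?_, ?_, ?_⟩
    · exact (isPreconnected_range hj.somePath.continuous).union x ⟨1, by simp⟩
        (Metric.mem_closedBall_self hε.le) (convex_closedBall x ε).isPreconnected
    · rintro y (⟨t, rfl⟩ | hy)
      · exact hj.somePath_mem t
      · exact hball hy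
    · exact .inl ⟨0, by simp⟩
    · rw [mem_interior_iff_mem_nhds]
      exact Filter.mem_of_superset (Metric.closedBall_mem_nhds x hε) Set.subset_union_right
  choose! M h1 h2 h3 h4 h5 using hM
  obtain ⟨t, htQ, ht⟩ := hQ.elim_nhds_subcover (fun x => interior (M x))
    (fun x hx => isOpen_interior.mem_nhds (h5 x hx))
  refine ⟨{w} ∪ ⋃ x ∈ t, M x, ?_, ?_, ?_, ?_⟩
  · exact isCompact_singleton.union (t.isCompact_biUnion fun x hx => h1 x (htQ x hx))
  · refine isPreconnected_of_forall w ?_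
    rintro y (rfl | hy)
    · exact ⟨{y}, Set.subset_union_left, rfl, rfl, isPreconnected_singleton⟩
    · obtain ⟨x, hx, hy⟩ := Set.mem_iUnion₂.1 hy
      exact ⟨M x, (Set.subset_biUnion_of_mem (u := M) (show x ∈ (t : Set X) from hx)).trans
        Set.subset_union_right, h4 x (htQ x hx), hy, h2 x (htQ x hx)⟩
  · refine ht.trans (Set.iUnion₂_subset fun x hx => interior_mono ?_)
    exact (Set.subset_biUnion_of_mem (u := M) (show x ∈ (t : Set X) from hx)).trans
        Set.subset_union_right
  · exact Set.union_subset (Set.singleton_subset_iff.2 hw)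
      (Set.iUnion₂_subset fun x hx => h3 x (htQ x hx))

/-- Discretization: connected open sets `W τ` in the plane that overlap only inside disjoint
connected open sets `U σ` are replaced by connected sets of grid points with the same
incidences. -/
theorem exists_grid_model {S T : Type*} [Finite S] [Finite T] (inc : T → S → Prop)
    (U : S → Set (EuclideanSpace ℝ (Fin 2))) (W : T → Set (EuclideanSpace ℝ (Fin 2)))
    (hU : ∀ σ, IsOpen (U σ)) (hUc : ∀ σ, IsPathConnected (U σ))
    (hW : ∀ τ, IsOpen (W τ)) (hWc : ∀ τ, IsPathConnected (W τ))
    (hUU : ∀ σ σ' x, x ∈ U σ → x ∈ U σ' → σ = σ')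
    (hWU : ∀ τ σ x, x ∈ W τ → x ∈ U σ → inc τ σ)
    (hWW : ∀ τ τ' x, τ ≠ τ' → x ∈ W τ → x ∈ W τ' → ∃ σ, x ∈ U σ)
    (hinc : ∀ τ σ, inc τ σ → U σ ⊆ W τ) :
    ∃ (N : ℕ) (C : S → Set (ℕ × ℕ)) (D : T → Set (ℕ × ℕ)),
      (∀ σ, IsLinked (gridFst (N := N)) gridSnd (C σ)) ∧ (∀ σ, (C σ).Nonempty) ∧
      (∀ σ σ' v, v ∈ C σ → v ∈ C σ' → σ = σ') ∧
      (∀ τ, IsLinked (gridFst (N := N)) gridSnd (D τ)) ∧ (⋃ τ, D τ).Finite ∧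
      (∀ τ σ v, v ∈ D τ → v ∈ C σ → inc τ σ) ∧
      (∀ τ τ' v, τ ≠ τ' → v ∈ D τ → v ∈ D τ' → ∃ σ, v ∈ C σ) ∧
      (∀ τ σ, inc τ σ → ∃ v, v ∈ D τ ∧ v ∈ C σ) := by
  classical
  choose c hc using fun σ => (hUc σ).nonempty
  have hP := fun τ => exists_isCompact_isPreconnected (hW τ) (hWc τ)
    (Q := c '' {σ | inc τ σ}) (Set.toFinite _).isCompact
    (by rintro _ ⟨σ, hσ, rfl⟩; exact hinc τ σ hσ (hc σ))
  choose P hPcomp hPconn hcP hPW using hP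
  -- The points where two of the sets `P τ` meet.
  set I : Set (EuclideanSpace ℝ (Fin 2)) :=
    ⋃ τ, ⋃ τ', {x | τ ≠ τ' ∧ x ∈ P τ ∧ x ∈ P τ'} with hI
  have hIcomp : IsCompact I := by
    refine isCompact_iUnion fun τ => isCompact_iUnion fun τ' => ?_
    by_cases h : τ = τ'
    · simp [h]
    · simpa [h] using (hPcomp τ).inter (hPcomp τ')
  have hIU : ∀ x ∈ I, ∃ σ, x ∈ U σ := by
    intro x hx
    simp only [hI, Set.mem_iUnion] at hx
    obtain ⟨τ, τ', h1, h2, h3⟩ := hx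
    exact hWW τ τ' x h1 (hPW _ h2) (hPW _ h3)
  have hK := fun σ => exists_isCompact_isPreconnected (hU σ) (hUc σ)
    (Q := {c σ} ∪ (I \ ⋃ σ', ⋃ _ : σ' ≠ σ, U σ'))
    (isCompact_singleton.union (hIcomp.diff (isOpen_iUnion fun σ' => isOpen_iUnion fun _ => hU σ')))
    (by
      rintro x (rfl | ⟨hx, hx'⟩)
      · exact hc σ
      · obtain ⟨σ', hσ'⟩ := hIU x hx
        by_cases h : σ' = σ
        · exact h ▸ hσ'
        · exact absurd (Set.mem_iUnion₂.2 ⟨σ', h, hσ'⟩) hx')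
  choose K hKcomp hKconn hQK hKU using hK
  have hIK : ∀ x ∈ I, ∃ σ, x ∈ interior (K σ) := by
    intro x hx
    obtain ⟨σ, hσ⟩ := hIU x hx
    refine ⟨σ, hQK σ (.inr ⟨hx, ?_⟩)⟩
    simp only [Set.mem_iUnion, not_exists]
    exact fun σ' hne hσ' => hne (hUU _ _ _ hσ' hσ)
  set O : Set (EuclideanSpace ℝ (Fin 2)) := ⋃ σ, interior (K σ) with hO
  have hOopen : IsOpen O := isOpen_iUnion fun σ => isOpen_interior
  have hmono : ∀ {p : ℝ → Prop}, (∃ δ > 0, p δ) → (∀ δ δ', 0 < δ' → δ' ≤ δ → p δ → p δ') →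
      ∀ᶠ δ in 𝓝[>] (0 : ℝ), p δ := by
    rintro p ⟨δ, hδ, hp⟩ hmono
    filter_upwards [Ioo_mem_nhdsGT hδ] with δ' hδ'
    exact hmono _ _ hδ'.1 hδ'.2.le hp
  have e1 : ∀ᶠ δ in 𝓝[>] (0 : ℝ), ∀ σ, Metric.thickening δ (K σ) ⊆ U σ :=
    Filter.eventually_all.2 fun σ =>
      hmono ((hKcomp σ).exists_thickening_subset_open (hU σ) (hKU σ))
        fun δ δ' _ hle h => (Metric.thickening_mono hle _).trans h
  have e2 : ∀ᶠ δ in 𝓝[>] (0 : ℝ), ∀ τ, Metric.thickening δ (P τ) ⊆ W τ :=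
    Filter.eventually_all.2 fun τ =>
      hmono ((hPcomp τ).exists_thickening_subset_open (hW τ) (hPW τ))
        fun δ δ' _ hle h => (Metric.thickening_mono hle _).trans h
  have e3 : ∀ᶠ δ in 𝓝[>] (0 : ℝ), ∀ τ τ', τ ≠ τ' →
      Disjoint (Metric.thickening δ (P τ \ O)) (Metric.thickening δ (P τ')) :=
    Filter.eventually_all.2 fun τ => Filter.eventually_all.2 fun τ' => by
      by_cases hne : τ = τ'
      · simp [hne]
      · simp only [ne_eq, hne, not_false_eq_true, true_imp_iff]
        refine hmono (Disjoint.exists_thickenings ?_ ((hPcomp τ).diff hOopen)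
          (hPcomp τ').isClosed) fun δ δ' _ hle h =>
            h.mono (Metric.thickening_mono hle _) (Metric.thickening_mono hle _)
        rw [Set.disjoint_left]
        rintro x ⟨hx, hxO⟩ hx'
        obtain ⟨σ, hσ⟩ := hIK x (Set.mem_iUnion₂.2 ⟨τ, τ', hne, hx, hx'⟩)
        exact hxO (Set.mem_iUnion.2 ⟨σ, hσ⟩)
  obtain ⟨δ, h1, h2, h3, hδ⟩ := (e1.and (e2.and (e3.and self_mem_nhdsWithin))).exists
  replace hδ : 0 < δ := hδ
  obtain ⟨R, hR⟩ := ((isCompact_iUnion hKcomp).union (isCompact_iUnion hPcomp)).isBounded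
    |>.exists_norm_le
  have hcoord : ∀ (x : EuclideanSpace ℝ (Fin 2)) i, ‖x‖ ≤ R → |x i| ≤ R := fun x i hx =>
    (PiLp.norm_apply_le x i).trans hx
  -- Coordinates in which the grid of mesh `h` becomes `ℕ × ℕ`.
  set h : ℝ := δ / 2 with hh
  have hpos : 0 < h := by positivity
  let u : EuclideanSpace ℝ (Fin 2) → ℝ := fun x => (x 0 + R) / h
  let v : EuclideanSpace ℝ (Fin 2) → ℝ := fun x => (x 1 + R) / h
  have hu : Continuous u := by fun_prop
  have hv : Continuous v := by fun_prop
  obtain ⟨N, hN⟩ := exists_nat_ge ((R + R) / h + 1)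
  have hbd : ∀ (x : EuclideanSpace ℝ (Fin 2)), ‖x‖ ≤ R → ∀ i,
      0 ≤ (x i + R) / h ∧ (x i + R) / h + 1 ≤ N := by
    intro x hx i
    have := abs_le.1 (hcoord x i hx)
    refine ⟨div_nonneg (by linarith) hpos.le, le_trans ?_ hN⟩
    gcongr
    exact this.2
  have hKR : ∀ σ, ∀ x ∈ K σ, ‖x‖ ≤ R := fun σ x hx => hR x (.inl (Set.mem_iUnion.2 ⟨σ, hx⟩))
  have hPR : ∀ τ, ∀ x ∈ P τ, ‖x‖ ≤ R := fun τ x hx => hR x (.inr (Set.mem_iUnion.2 ⟨τ, hx⟩))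
  let pt : ℕ × ℕ → EuclideanSpace ℝ (Fin 2) := fun p => !₂[h * p.1 - R, h * p.2 - R]
  have hdist : ∀ (x : EuclideanSpace ℝ (Fin 2)) (p : ℕ × ℕ), |u x - p.1| < 1 → |v x - p.2| < 1 →
      dist (pt p) x < δ := by
    intro x p hp1 hp2
    have key : ∀ (t : ℝ) (n : ℕ), |(t + R) / h - n| < 1 → |h * n - R - t| < h := by
      intro t n ht
      have : h * n - R - t = -(h * ((t + R) / h - n)) := by field_simp; ring
      rw [this, abs_neg, abs_mul, abs_of_pos hpos]
      nlinarith
    have k1 := key _ _ hp1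
    have k2 := key _ _ hp2
    rw [EuclideanSpace.dist_eq, Fin.sum_univ_two]
    simp only [Real.dist_eq, pt, Matrix.cons_val_zero, Matrix.cons_val_one]
    rw [Real.sqrt_lt' hδ]
    nlinarith [abs_nonneg (h * p.1 - R - x 0), abs_nonneg (h * p.2 - R - x 1)]
  have hthick : ∀ {A : Set (EuclideanSpace ℝ (Fin 2))} {p}, p ∈ gridNear u v A →
      pt p ∈ Metric.thickening δ A := by
    rintro A p ⟨x, hx, hp1, hp2⟩
    exact Metric.mem_thickening_iff.2 ⟨x, hx, hdist x p hp1 hp2⟩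
  have hfloor : ∀ x : EuclideanSpace ℝ (Fin 2), ‖x‖ ≤ R → ∀ {A : Set (EuclideanSpace ℝ (Fin 2))},
      x ∈ A → (⌊u x⌋₊, ⌊v x⌋₊) ∈ gridNear u v A := fun x hx A hxA =>
    ⟨x, hxA, abs_sub_floor_lt (hbd x hx 0).1, abs_sub_floor_lt (hbd x hx 1).1⟩
  have hcK : ∀ σ, c σ ∈ K σ := fun σ => interior_subset (hQK σ (.inl rfl))
  refine ⟨N, fun σ => gridNear u v (K σ), fun τ => gridNear u v (P τ), ?_, ?_, ?_, ?_, ?_, ?_, ?_,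
    ?_⟩
  · exact fun σ => isLinked_gridNear hu hv (hKconn σ) (fun x hx => (hbd x (hKR σ x hx) 0).1)
      (fun x hx => (hbd x (hKR σ x hx) 1).1) (fun x hx => (hbd x (hKR σ x hx) 0).2)
      (fun x hx => (hbd x (hKR σ x hx) 1).2)
  · exact fun σ => ⟨_, hfloor (c σ) (hKR σ _ (hcK σ)) (hcK σ)⟩
  · exact fun σ σ' p hp hp' => hUU _ _ _ (h1 σ (hthick hp)) (h1 σ' (hthick hp'))
  · exact fun τ => isLinked_gridNear hu hv (hPconn τ) (fun x hx => (hbd x (hPR τ x hx) 0).1)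
      (fun x hx => (hbd x (hPR τ x hx) 1).1) (fun x hx => (hbd x (hPR τ x hx) 0).2)
      (fun x hx => (hbd x (hPR τ x hx) 1).2)
  · refine ((Set.finite_Iio N).prod (Set.finite_Iio N)).subset (Set.iUnion_subset fun τ => ?_)
    rintro p ⟨x, hx, hp1, hp2⟩
    have b1 := (hbd x (hPR τ x hx) 0).2
    have b2 := (hbd x (hPR τ x hx) 1).2
    have c1 := (abs_lt.1 hp1).1
    have c2 := (abs_lt.1 hp2).1
    refine ⟨?_, ?_⟩
    · have : (p.1 : ℝ) < N := by simp only [u] at c1; linarith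
      exact_mod_cast this
    · have : (p.2 : ℝ) < N := by simp only [v] at c2; linarith
      exact_mod_cast this
  · exact fun τ σ p hp hp' => hWU _ _ _ (h2 τ (hthick hp)) (h1 σ (hthick hp'))
  · intro τ τ' p hne hp hp'
    obtain ⟨x, hx, hp1, hp2⟩ := hp
    by_cases hxO : x ∈ O
    · obtain ⟨σ, hσ⟩ := Set.mem_iUnion.1 hxO
      exact ⟨σ, x, interior_subset hσ, hp1, hp2⟩
    · exact absurd (hthick hp') (Set.disjoint_left.1 (h3 τ τ' hne)
        (hthick ⟨x, ⟨hx, hxO⟩, hp1, hp2⟩))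
  · intro τ σ hσ
    exact ⟨_, hfloor (c σ) (hKR σ _ (hcK σ)) (interior_subset (hcP τ ⟨σ, hσ, rfl⟩)),
      hfloor (c σ) (hKR σ _ (hcK σ)) (hcK σ)⟩

/-! ### Faces of the nerve -/

section Nerve

variable {X : Type*} {n : ℕ} {A : Fin n → Set X}

theorem inter_anti {σ τ : Finset (Fin n)} (h : τ ⊆ σ) : inter A σ ⊆ inter A τ :=
  Set.biInter_subset_biInter_left h

theorem inter_union (σ τ : Finset (Fin n)) : inter A (σ ∪ τ) = inter A σ ∩ inter A τ :=
  Finset.set_biInter_inter _ _ _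

theorem card_le_of_mem_nerve {m : ℕ} (hf : faceCount A m = 0) {σ : Finset (Fin n)}
    (hσ : σ ∈ nerve A) : σ.card ≤ m := by
  by_contra hlt
  obtain ⟨ρ, hρ, hcard⟩ := Finset.exists_subset_card_eq (Nat.lt_of_not_le hlt)
  rw [faceCount, Set.ncard_eq_zero (Set.toFinite _)] at hf
  exact Set.notMem_empty ρ (hf ▸ ⟨Set.Nonempty.mono (inter_anti hρ) hσ, hcard⟩)

/-- Two distinct sets of the same size `m`, whose union is a face of a nerve with faces of size at
most `m + 1`, have a union of size `m + 1`. -/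
theorem card_union_eq_of_mem_nerve {m : ℕ} (hf : faceCount A (m + 1) = 0) {σ τ : Finset (Fin n)}
    (hσ : σ.card = m) (hτ : τ.card = m) (hne : σ ≠ τ) (h : σ ∪ τ ∈ nerve A) :
    (σ ∪ τ).card = m + 1 := by
  refine le_antisymm (card_le_of_mem_nerve hf h) (Nat.succ_le_of_lt ?_)
  by_contra hlt
  have h1 : σ = σ ∪ τ := Finset.eq_of_subset_of_card_le Finset.subset_union_left (by omega)
  have h2 : τ = σ ∪ τ := Finset.eq_of_subset_of_card_le Finset.subset_union_right (by omega)
  exact hne (h1.trans h2.symm)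

/-- Faces of the maximal size that have a common point coincide. -/
theorem eq_of_mem_inter {m : ℕ} (hf : faceCount A m = 0) {σ τ : Finset (Fin n)}
    (hσ : σ.card = m) (hτ : τ.card = m) {x : X} (hx : x ∈ inter A σ) (hx' : x ∈ inter A τ) :
    σ = τ := by
  have h : (σ ∪ τ).card ≤ m := card_le_of_mem_nerve hf ⟨x, by rw [inter_union]; exact ⟨hx, hx'⟩⟩
  have h1 : σ = σ ∪ τ := Finset.eq_of_subset_of_card_le Finset.subset_union_left (by omega)
  have h2 : τ = σ ∪ τ := Finset.eq_of_subset_of_card_le Finset.subset_union_right (by omega)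
  exact h1.trans h2.symm

/-- The index sets `σ` of size `m` with `A_σ` nonempty and open. -/
noncomputable def openFaces [TopologicalSpace X] (A : Fin n → Set X) (m : ℕ) :
    Finset (Finset (Fin n)) := by
  classical exact Finset.univ.filter fun σ => σ.card = m ∧ (inter A σ).Nonempty ∧ IsOpen (inter A σ)

theorem mem_openFaces [TopologicalSpace X] {m : ℕ} {σ : Finset (Fin n)} :
    σ ∈ openFaces A m ↔ σ.card = m ∧ (inter A σ).Nonempty ∧ IsOpen (inter A σ) := by
  simp [openFaces]

/-- The index sets of size `k` contained in a member of `openFaces A (k + 1)`. -/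
noncomputable def openRidges [TopologicalSpace X] (A : Fin n → Set X) (k : ℕ) :
    Finset (Finset (Fin n)) := by
  classical exact Finset.univ.filter fun τ => τ.card = k ∧ ∃ σ ∈ openFaces A (k + 1), τ ⊆ σ

theorem mem_openRidges [TopologicalSpace X] {k : ℕ} {τ : Finset (Fin n)} :
    τ ∈ openRidges A k ↔ τ.card = k ∧ ∃ σ ∈ openFaces A (k + 1), τ ⊆ σ := by
  simp [openRidges]

theorem sum_card_openFaces_above [TopologicalSpace X] (k : ℕ) :
    ∑ τ : openRidges A k, Fintype.card {σ : openFaces A (k + 1) // τ.1 ⊆ σ.1} =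
      (k + 1) * (openFaces A (k + 1)).card := by
  classical
  have h1 := Finset.sum_card_bipartiteAbove_eq_sum_card_bipartiteBelow
    (s := (Finset.univ : Finset (openRidges A k)))
    (t := (Finset.univ : Finset (openFaces A (k + 1)))) (fun τ σ => τ.1 ⊆ σ.1)
  simp only [Finset.bipartiteAbove, Finset.bipartiteBelow] at h1
  simp only [Fintype.card_subtype, h1]
  have h2 : ∀ σ : openFaces A (k + 1),
      (Finset.univ.filter fun τ : openRidges A k => τ.1 ⊆ σ.1).card = k + 1 := by
    intro σ
    have hσ : (σ.1.powersetCard k).card = k + 1 := by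
      rw [Finset.card_powersetCard, (mem_openFaces.1 σ.2).1, Nat.choose_succ_self_right]
    rw [← Finset.card_map (Function.Embedding.subtype _)]
    refine (congrArg Finset.card ?_).trans hσ
    ext τ
    simp only [Finset.mem_map, Finset.mem_filter, Finset.mem_univ, true_and,
      Function.Embedding.coe_subtype, Finset.mem_powersetCard]
    constructor
    · rintro ⟨ρ, hρ, rfl⟩
      exact ⟨hρ, (mem_openRidges.1 ρ.2).1⟩
    · rintro ⟨h1, h2⟩
      exact ⟨⟨τ, mem_openRidges.2 ⟨h2, σ, σ.2, h1⟩⟩, h1, rfl⟩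
  simp only [h2, Finset.sum_const, Finset.card_univ, Fintype.card_coe, smul_eq_mul, mul_comm]

end Nerve

section Plane

variable {k n : ℕ} {A : Fin n → Set (EuclideanSpace ℝ (Fin 2))}

theorem isPathConnected_of_isOpen
    (hA : ∀ σ : Finset (Fin n), (σ.card = k ∨ σ.card = k + 1) →
      inter A σ = ∅ ∨ (∃ p, inter A σ = {p}) ∨
        (IsOpen (inter A σ) ∧ IsPathConnected (inter A σ)))
    {σ τ : Finset (Fin n)} (hτ : τ.card = k ∨ τ.card = k + 1) (hsub : τ ⊆ σ)
    (hne : (inter A σ).Nonempty) (ho : IsOpen (inter A σ)) :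
    IsOpen (inter A τ) ∧ IsPathConnected (inter A τ) := by
  obtain ⟨x, hx⟩ := hne
  rcases hA τ hτ with h | ⟨p, h⟩ | h
  · exact absurd (inter_anti hsub hx) (by rw [h]; exact Set.notMem_empty x)
  · have h1 : inter A σ ⊆ {p} := h ▸ inter_anti hsub
    have h2 : inter A σ = {x} := by
      refine Set.Subset.antisymm (fun y hy => ?_) (Set.singleton_subset_iff.2 hx)
      rw [Set.mem_singleton_iff, Set.mem_singleton_iff.1 (h1 hy), Set.mem_singleton_iff.1 (h1 hx)]
    rw [h2] at ho
    exact absurd ho (not_isOpen_singleton x)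
  · exact h

/-- The theorem for the faces with open intersection: the planar graph on them, with one tree for
every ridge, has `(k + 1) |openFaces| - |openRidges|` edges. -/
theorem card_openFaces_le (hk : 1 ≤ k) (hf : faceCount A (k + 1) = 0)
    (hA : ∀ σ : Finset (Fin n), (σ.card = k ∨ σ.card = k + 1) →
      inter A σ = ∅ ∨ (∃ p, inter A σ = {p}) ∨
        (IsOpen (inter A σ) ∧ IsPathConnected (inter A σ))) :
    (4 * k + 1) * ((k + 1) * (openFaces A (k + 1)).card) ≤
      12 * k * (openFaces A (k + 1)).card + (4 * k + 1) * (openRidges A k).card := by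
  classical
  rcases (openFaces A (k + 1)).eq_empty_or_nonempty with h0 | ⟨σ₀, hσ₀⟩
  · simp [h0]
  let S := {σ // σ ∈ openFaces A (k + 1)}
  let T := {τ // τ ∈ openRidges A k}
  have : Nonempty S := ⟨⟨σ₀, hσ₀⟩⟩
  have hS : ∀ σ : S, σ.1.card = k + 1 := fun σ => (mem_openFaces.1 σ.2).1
  have hT : ∀ τ : T, τ.1.card = k := fun τ => (mem_openRidges.1 τ.2).1
  have hSo : ∀ σ : S, IsOpen (inter A σ.1) ∧ IsPathConnected (inter A σ.1) := fun σ =>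
    isPathConnected_of_isOpen hA (.inr (hS σ)) subset_rfl (mem_openFaces.1 σ.2).2.1
      (mem_openFaces.1 σ.2).2.2
  have hTo : ∀ τ : T, IsOpen (inter A τ.1) ∧ IsPathConnected (inter A τ.1) := fun τ => by
    obtain ⟨σ, hσ, hτσ⟩ := (mem_openRidges.1 τ.2).2
    exact isPathConnected_of_isOpen hA (.inl (hT τ)) hτσ (mem_openFaces.1 hσ).2.1
      (mem_openFaces.1 hσ).2.2
  have hSS : ∀ (σ σ' : S) x, x ∈ inter A σ.1 → x ∈ inter A σ'.1 → σ = σ' :=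
    fun σ σ' x hx hx' => Subtype.ext (eq_of_mem_inter hf (hS σ) (hS σ') hx hx')
  have hTS : ∀ (τ : T) (σ : S) x, x ∈ inter A τ.1 → x ∈ inter A σ.1 → τ.1 ⊆ σ.1 := by
    intro τ σ x hx hx'
    have h1 : (σ.1 ∪ τ.1).card ≤ k + 1 :=
      card_le_of_mem_nerve hf ⟨x, by rw [inter_union]; exact ⟨hx', hx⟩⟩
    have h2 : σ.1 = σ.1 ∪ τ.1 := Finset.eq_of_subset_of_card_le Finset.subset_union_left
      (by rw [hS]; exact h1)
    rw [h2]
    exact Finset.subset_union_right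
  have hTT : ∀ (τ τ' : T) x, τ ≠ τ' → x ∈ inter A τ.1 → x ∈ inter A τ'.1 →
      ∃ σ : S, x ∈ inter A σ.1 := by
    intro τ τ' x hne hx hx'
    have hxu : x ∈ inter A (τ.1 ∪ τ'.1) := by rw [inter_union]; exact ⟨hx, hx'⟩
    refine ⟨⟨τ.1 ∪ τ'.1, mem_openFaces.2 ⟨?_, ⟨x, hxu⟩, ?_⟩⟩, hxu⟩
    · exact card_union_eq_of_mem_nerve hf (hT τ) (hT τ') (fun h => hne (Subtype.ext h)) ⟨x, hxu⟩
    · rw [inter_union]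
      exact (hTo τ).1.inter (hTo τ').1
  have hinter : ∀ (τ : T) (σ σ' : S), σ ≠ σ' → τ.1 ⊆ σ.1 → τ.1 ⊆ σ'.1 → σ.1 ∩ σ'.1 = τ.1 := by
    intro τ σ σ' hne h1 h2
    refine (Finset.eq_of_subset_of_card_le (Finset.subset_inter h1 h2) ?_).symm
    rw [hT]
    by_contra hlt
    have h3 : σ.1 ∩ σ'.1 = σ.1 := Finset.eq_of_subset_of_card_le Finset.inter_subset_left
      (by rw [hS]; omega)
    have h4 : σ.1 ∩ σ'.1 = σ'.1 := Finset.eq_of_subset_of_card_le Finset.inter_subset_right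
      (by rw [hS]; omega)
    exact hne (Subtype.ext (h3.symm.trans h4))
  obtain ⟨N, C, D, hC, hCne, hCC, hD, hfin, hDC, hDD, hne⟩ :=
    exists_grid_model (S := S) (T := T) (fun τ σ => τ.1 ⊆ σ.1) (fun σ => inter A σ.1)
      (fun τ => inter A τ.1) (fun σ => (hSo σ).1) (fun σ => (hSo σ).2) (fun τ => (hTo τ).1)
      (fun τ => (hTo τ).2) hSS hTS hTT (fun τ σ h => inter_anti h)
  have hne' : ∀ τ : T, ∃ σ : S, τ.1 ⊆ σ.1 := fun τ => by
    obtain ⟨σ, hσ, hτσ⟩ := (mem_openRidges.1 τ.2).2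
    exact ⟨⟨σ, hσ⟩, hτσ⟩
  obtain ⟨C', h1, h2, h3, h4, h5⟩ := exists_linked_cover (fun (τ : T) (σ : S) => τ.1 ⊆ σ.1) C D hC
    hCC hD hfin hDC hDD (fun τ => by
      obtain ⟨σ, hσ⟩ := hne' τ
      exact ⟨σ, hne τ σ hσ⟩)
  obtain ⟨E, _, F, a, b, l, r, lab, hdual, hab, hinj, hlab, htri, hcard⟩ :=
    (isDual_grid N).exists_tree_minor (fun (τ : T) (σ : S) => τ.1 ⊆ σ.1) C' D h2
      (fun σ => (hCne σ).mono (h1 σ)) h3 hD h4 h5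
      (fun τ σ h => (hne τ σ h).imp fun v hv => ⟨hv.1, h1 σ hv.2⟩) hne'
      (fun τ τ' σ σ' hσ h h' h'' h''' => Subtype.ext
        ((hinter τ σ σ' hσ h h').symm.trans (hinter τ' σ σ' hσ h'' h''')))
  have hlab' : ∀ e, (a e).1 ∩ (b e).1 = (lab e).1 := fun e =>
    hinter _ _ _ (hab e) (hlab e).1 (hlab e).2
  have hlab2 : ∀ e x y, s(a e, b e) = s(x, y) → x.1 ∩ y.1 = (lab e).1 := by
    intro e x y h
    rw [← hlab']
    rcases Sym2.eq_iff.1 h with ⟨rfl, rfl⟩ | ⟨rfl, rfl⟩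
    · rfl
    · exact Finset.inter_comm _ _
  have hmain := hdual.mul_card_edges_le (s := fun σ : S => σ.1) Subtype.val_injective hS hk hab hinj
    (fun e => by rw [hlab', hT]) (fun e₁ e₂ e₃ x y z hx hy hz ⟨h, h'⟩ => by
      rw [hlab2 _ _ _ hx, hlab2 _ _ _ hy] at h
      rw [hlab2 _ _ _ hy, hlab2 _ _ _ hz] at h'
      exact htri e₁ e₂ e₃ x y z hx hy hz ⟨Subtype.ext h, Subtype.ext h'⟩)
  have hsum := sum_card_openFaces_above (A := A) k
  rw [← hsum]
  have e1 : Fintype.card S = (openFaces A (k + 1)).card := by simp [S]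
  have e2 : Fintype.card T = (openRidges A k).card := by simp [T]
  rw [e1] at hmain
  rw [e2] at hcard
  have e3 : ∑ τ : openRidges A k, Fintype.card {σ : openFaces A (k + 1) // τ.1 ⊆ σ.1} =
      Fintype.card E + (openRidges A k).card := by
    rw [hcard]
    exact Finset.sum_congr rfl fun τ _ => by congr!
  rw [e3, mul_add]
  omega

/-- Each of the faces `σ` of size `k + 1` for which `A_σ` is not open is a point; then at most one
of the `A_τ` with `τ ⊆ σ` of size `k` is open, and the others, points as well, belong to no other
face. -/
theorem card_add_le_indFaceCount (hk : 1 ≤ k) (hf : faceCount A (k + 1) = 0)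
    (hA : ∀ σ : Finset (Fin n), (σ.card = k ∨ σ.card = k + 1) →
      inter A σ = ∅ ∨ (∃ p, inter A σ = {p}) ∨
        (IsOpen (inter A σ) ∧ IsPathConnected (inter A σ))) :
    ∃ m, faceCount A k = (openFaces A (k + 1)).card + m ∧
      (openRidges A k).card + k * m ≤ indFaceCount A (k - 1) := by
  classical
  set Q : Finset (Finset (Fin n)) := Finset.univ.filter fun σ =>
    σ.card = k + 1 ∧ (inter A σ).Nonempty ∧ ¬ IsOpen (inter A σ) with hQ
  have memQ : ∀ {σ}, σ ∈ Q ↔ σ.card = k + 1 ∧ (inter A σ).Nonempty ∧ ¬ IsOpen (inter A σ) := by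
    intro σ; simp [hQ]
  let B : Finset (Fin n) → Finset (Finset (Fin n)) := fun σ =>
    (σ.powersetCard k).filter fun τ => ¬ IsOpen (inter A τ)
  have memB : ∀ {σ τ}, τ ∈ B σ ↔ (τ ⊆ σ ∧ τ.card = k) ∧ ¬ IsOpen (inter A τ) := by
    intro σ τ; simp [B, Finset.mem_powersetCard]
  have hBeq : ∀ {σ τ}, (inter A σ).Nonempty → τ ∈ B σ → inter A τ = inter A σ := by
    intro σ τ hne hτ
    obtain ⟨⟨hsub, hcard⟩, ho⟩ := memB.1 hτ
    obtain ⟨x, hx⟩ := hne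
    have hxτ := inter_anti hsub hx
    rcases hA τ (.inl hcard) with h | ⟨p, h⟩ | h
    · rw [h] at hxτ
      exact absurd hxτ (Set.notMem_empty x)
    · refine (Set.Subset.antisymm (inter_anti hsub) fun y hy => ?_).symm
      rw [h] at hxτ hy
      rw [Set.mem_singleton_iff.1 hy, ← Set.mem_singleton_iff.1 hxτ]
      exact hx
    · exact absurd h.1 ho
  have hBcard : ∀ σ ∈ Q, k ≤ (B σ).card := by
    intro σ hσ
    obtain ⟨hcard, hne, ho⟩ := memQ.1 hσ
    have hle : ((σ.powersetCard k).filter fun τ => IsOpen (inter A τ)).card ≤ 1 := by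
      rw [Finset.card_le_one]
      intro τ hτ τ' hτ'
      simp only [Finset.mem_filter, Finset.mem_powersetCard] at hτ hτ'
      by_contra hne'
      have hsub := Finset.union_subset hτ.1.1 hτ'.1.1
      have hu : τ ∪ τ' = σ := Finset.eq_of_subset_of_card_le hsub (by
        rw [hcard, card_union_eq_of_mem_nerve hf hτ.1.2 hτ'.1.2 hne'
          (Set.Nonempty.mono (inter_anti hsub) hne)])
      apply ho
      rw [← hu, inter_union]
      exact hτ.2.inter hτ'.2
    have := Finset.card_filter_add_card_filter_not (s := σ.powersetCard k)
      (fun τ => IsOpen (inter A τ))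
    rw [Finset.card_powersetCard, hcard, Nat.choose_succ_self_right] at this
    change _ + (B σ).card = _ at this
    omega
  refine ⟨Q.card, ?_, ?_⟩
  · have hdisj : Disjoint (openFaces A (k + 1)) Q := Finset.disjoint_left.2 fun σ h1 h2 =>
      (memQ.1 h2).2.2 (mem_openFaces.1 h1).2.2
    rw [← Finset.card_union_of_disjoint hdisj, ← Set.ncard_coe_finset, faceCount]
    congr 1
    ext σ
    simp only [nerve, Set.mem_ofPred_eq, Finset.coe_union, Set.mem_union, Finset.mem_coe,
      mem_openFaces, memQ]
    tauto
  · have hBdisj : (Q : Set (Finset (Fin n))).PairwiseDisjoint B := by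
      intro σ hσ σ' hσ' hne
      refine Finset.disjoint_left.2 fun τ hτ hτ' => hne ?_
      obtain ⟨h1, ⟨x, hx⟩, -⟩ := memQ.1 hσ
      obtain ⟨h1', h2', -⟩ := memQ.1 hσ'
      refine eq_of_mem_inter hf h1 h1' hx ?_
      rw [← hBeq h2' hτ', hBeq ⟨x, hx⟩ hτ]
      exact hx
    have hdisj : Disjoint (openRidges A k) (Q.biUnion B) := by
      refine Finset.disjoint_left.2 fun τ hτ hτ' => ?_
      obtain ⟨σ', -, hτ'⟩ := Finset.mem_biUnion.1 hτ'
      obtain ⟨hcard, σ, hσ, hsub⟩ := mem_openRidges.1 hτ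
      exact (memB.1 hτ').2 (isPathConnected_of_isOpen hA (.inl hcard) hsub
        (mem_openFaces.1 hσ).2.1 (mem_openFaces.1 hσ).2.2).1
    have hle : k * Q.card ≤ (Q.biUnion B).card := by
      rw [Finset.card_biUnion hBdisj, mul_comm]
      exact Finset.card_nsmul_le_sum _ _ _ hBcard
    have hind : (openRidges A k ∪ Q.biUnion B).card ≤ indFaceCount A (k - 1) := by
      rw [← Set.ncard_coe_finset, indFaceCount]
      refine Set.ncard_le_ncard (fun τ hτ => ?_) (Set.toFinite _)
      have key : ∃ σ, τ ⊆ σ ∧ τ.card = k ∧ σ.card = k + 1 ∧ (inter A σ).Nonempty := by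
        rcases Finset.mem_union.1 (Finset.mem_coe.1 hτ) with h | h
        · obtain ⟨hcard, σ, hσ, hsub⟩ := mem_openRidges.1 h
          exact ⟨σ, hsub, hcard, (mem_openFaces.1 hσ).1, (mem_openFaces.1 hσ).2.1⟩
        · obtain ⟨σ, hσ, hτσ⟩ := Finset.mem_biUnion.1 h
          exact ⟨σ, (memB.1 hτσ).1.1, (memB.1 hτσ).1.2, (memQ.1 hσ).1, (memQ.1 hσ).2.1⟩
      obtain ⟨σ, hsub, hτk, hσk, hne⟩ := key
      refine ⟨hne.mono (inter_anti hsub), by omega, σ, hne, ?_, by omega⟩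
      refine Finset.ssubset_iff_subset_ne.2 ⟨hsub, ?_⟩
      rintro rfl
      omega
    rw [Finset.card_union_of_disjoint hdisj] at hind
    omega

end Plane

end PlanarNerve

theorem theorem2p1 (k : ℕ) (hk : 2 ≤ k) (n : ℕ)
    (A : Fin n → Set (EuclideanSpace ℝ (Fin 2)))
    (hf : PlanarNerve.faceCount A (k + 1) = 0)
    (hA : ∀ σ : Finset (Fin n), (σ.card = k ∨ σ.card = k + 1) →
      PlanarNerve.inter A σ = ∅ ∨ (∃ p, PlanarNerve.inter A σ = {p}) ∨
        (IsOpen (PlanarNerve.inter A σ) ∧ IsPathConnected (PlanarNerve.inter A σ))) :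
    0 < PlanarNerve.boundConst k ∧
      (PlanarNerve.faceCount A k : ℝ) ≤
        PlanarNerve.boundConst k * (PlanarNerve.indFaceCount A (k - 1) : ℝ) := by
  have hk' : (2 : ℝ) ≤ k := by exact_mod_cast hk
  have hden : 0 < 4 * (k : ℝ) ^ 2 - 7 * (k : ℝ) + 1 := by nlinarith
  refine ⟨div_pos (by positivity) hden, ?_⟩
  obtain ⟨m, h1, h2⟩ := PlanarNerve.card_add_le_indFaceCount (by omega) hf hA
  have h3 := PlanarNerve.card_openFaces_le (by omega) hf hA
  rw [PlanarNerve.boundConst, div_mul_eq_mul_div, le_div_iff₀ hden, h1]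
  have h2' : ((PlanarNerve.openRidges A k).card + k * m : ℝ) ≤
      PlanarNerve.indFaceCount A (k - 1) := by
    exact_mod_cast h2
  have h3' : (4 * k + 1 : ℝ) * ((k + 1) * (PlanarNerve.openFaces A (k + 1)).card) ≤
      12 * k * (PlanarNerve.openFaces A (k + 1)).card +
        (4 * k + 1) * (PlanarNerve.openRidges A k).card := by
    exact_mod_cast h3
  push_cast
  have hm : (0 : ℝ) ≤ m * k := by positivity
  nlinarith [mul_le_mul_of_nonneg_left h2' (show (0 : ℝ) ≤ 4 * k + 1 by positivity)]
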